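/- Let $(M,g)$ be a smooth Lorentzian manifold of dimension $n\ge 3$, of signature $(-,+,\dots,+)$, with Levi-Civita connection $\nabla$. The curvature conventions are $$[\nabla_i,\nabla_j]\omega_k=R_{ijk}{}^m\omega_m,\qquad R_{kl}=R_{kjl}{}^j,\qquad R=g^{kl}R_{kl},$$ $$C_{jklm}=R_{jklm}+\tfrac{1}{n-2}\left(g_{jm}R_{kl}-g_{km}R_{jl}+R_{jm}g_{kl}-R_{km}g_{jl}\right)-R\,\frac{g_{jm}g_{kl}-g_{jl}g_{km}}{(n-1)(n-2)} .$$ $(M,g)$ is a generalized Robertson-Walker (GRW) manifold if around every point there are coordinates $(t,x)$ in which $ds^2=-dt^2+q(t)^2g^*_{\mu\nu}(x)\,dx^\mu dx^\nu$, with $q>0$ a smooth function of $t$ and $g^*$ a Riemannian metric in the variables $x$. A Chen vector on an open set $U\subseteq M$ is a smooth vector field $X$ on $U$ such that $X^2:=X^jX_j<0$ and $\nabla_jX_k=\rho\, g_{jk}$ on $U$, for some smooth scalar field $\rho$. **Theorem.** If $(M,g)$ is a GRW manifold, then every point of $M$ has an open neighbourhood carrying a Chen vector. Moreover, for every open set $U\subseteq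 M$ (for instance $U=M$) and every Chen vector $X$ on $U$ with scalar field $\rho$, there are smooth scalar fields $\xi$ and $\theta$ on $U$ such that, on $U$ and in all coordinate systems: 1. $X$ is an eigenvector of the Ricci tensor, $R_{jm}X^m=\xi X_j$, with $$\xi=-(n-1)\frac{X^k\nabla_k\rho}{X^2},\qquad \nabla_i\xi=\theta X_i ;$$ 2. the Ricci tensor is $$R_{kl}=(n-2)\,C_{jklm}\frac{X^jX^m}{X^2}+\frac{R-\xi}{n-1}\left(g_{kl}-\frac{X_kX_l}{X^2}\right)+\xi\,\frac{X_kX_l}{X^2} .$$ -/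

import Mathlib

open scoped Manifold ContDiff Bundle

noncomputable section

namespace GRW

variable {n : ℕ} [NeZero n] {M : Type*} [TopologicalSpace M]
  [ChartedSpace (EuclideanSpace ℝ (Fin n)) M] [IsManifold (𝓡 n) ∞ M]

variable (n M) in
/-- A smooth Lorentzian metric of signature `(-, +, …, +)` on the `n`-dimensional smooth
manifold `M`. -/
structure LorentzMetric where
  /-- The metric at a point, as a bilinear form on the tangent space. -/
  inner (p : M) : TangentSpace (𝓡 n) p →L[ℝ] TangentSpace (𝓡 n) p →L[ℝ] ℝ
  symm (p : M) (v w : TangentSpace (𝓡 n) p) : inner p v w = inner p w v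
  lorentzian (p : M) : ∃ b : Module.Basis (Fin n) ℝ (TangentSpace (𝓡 n) p), ∀ i j : Fin n,
    inner p (b i) (b j) = if i = j then (if i = 0 then -1 else 1) else 0
  contMDiff : ContMDiff (𝓡 n)
    ((𝓡 n).prod 𝓘(ℝ, EuclideanSpace ℝ (Fin n) →L[ℝ] EuclideanSpace ℝ (Fin n) →L[ℝ] ℝ)) ∞
    (fun p : M ↦ Bundle.TotalSpace.mk'
      (EuclideanSpace ℝ (Fin n) →L[ℝ] EuclideanSpace ℝ (Fin n) →L[ℝ] ℝ)
      (E := fun p : M ↦ TangentSpace (𝓡 n) p →L[ℝ] TangentSpace (𝓡 n) p →L[ℝ] ℝ) p (inner p))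

/-- The partial derivative `∂ᵢ f` of a function on coordinate space. -/
def partialD (i : Fin n) (f : EuclideanSpace ℝ (Fin n) → ℝ) (y : EuclideanSpace ℝ (Fin n)) : ℝ :=
  fderiv ℝ f y (EuclideanSpace.single i 1)

/-- The coordinate vector `∂ᵢ` of the chart `φ`, at the point with coordinates `y`. -/
def coordVec (φ : OpenPartialHomeomorph M (EuclideanSpace ℝ (Fin n))) (i : Fin n)
    (y : EuclideanSpace ℝ (Fin n)) : TangentSpace (𝓡 n) (φ.symm y) :=
  mfderiv (𝓡 n) (𝓡 n) φ.symm y (EuclideanSpace.single i (1 : ℝ) : EuclideanSpace ℝ (Fin n))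

/-- The contravariant components `Xⁱ` of a vector field in the chart `φ`. -/
def vecUp (φ : OpenPartialHomeomorph M (EuclideanSpace ℝ (Fin n)))
    (X : (p : M) → TangentSpace (𝓡 n) p) (i : Fin n) (y : EuclideanSpace ℝ (Fin n)) : ℝ :=
  let v : EuclideanSpace ℝ (Fin n) := mfderiv (𝓡 n) (𝓡 n) φ (φ.symm y) (X (φ.symm y))
  v i

namespace LorentzMetric

variable (g : LorentzMetric n M) (φ : OpenPartialHomeomorph M (EuclideanSpace ℝ (Fin n)))

/-- The components `gᵢⱼ` of the metric in the chart `φ`, as functions of the coordinates. -/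
def metric (i j : Fin n) (y : EuclideanSpace ℝ (Fin n)) : ℝ :=
  g.inner (φ.symm y) (coordVec φ i y) (coordVec φ j y)

/-- The components `gⁱʲ` of the inverse metric in the chart `φ`. -/
def invMetric (i j : Fin n) (y : EuclideanSpace ℝ (Fin n)) : ℝ :=
  (Matrix.of fun a b : Fin n ↦ g.metric φ a b y)⁻¹ i j

/-- The Christoffel symbols `Γᵏᵢⱼ` of the Levi-Civita connection. -/
def christoffel (k i j : Fin n) (y : EuclideanSpace ℝ (Fin n)) : ℝ :=
  (1 / 2) * ∑ l, g.invMetric φ k l y *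
    (partialD i (g.metric φ l j) y + partialD j (g.metric φ l i) y - partialD l (g.metric φ i j) y)

/-- The components `Rᵢⱼₖᵐ` of the Riemann tensor, with the sign convention
`[∇ᵢ, ∇ⱼ] ωₖ = Rᵢⱼₖᵐ ωₘ` for covectors `ω`. -/
def riemannUp (i j k m : Fin n) (y : EuclideanSpace ℝ (Fin n)) : ℝ :=
  partialD j (g.christoffel φ m i k) y - partialD i (g.christoffel φ m j k) y
    + ∑ s, (g.christoffel φ s i k y * g.christoffel φ m j s y
      - g.christoffel φ s j k y * g.christoffel φ m i s y)

/-- The components `Rᵢⱼₖₘ` of the Riemann tensor. -/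
def riemann (i j k m : Fin n) (y : EuclideanSpace ℝ (Fin n)) : ℝ :=
  ∑ s, g.riemannUp φ i j k s y * g.metric φ s m y

/-- The Ricci tensor `Rₖₗ = Rₖⱼₗʲ`; with the sign convention of `riemannUp` this is the usual Ricci
tensor, which is positive on round spheres. -/
def ricci (k l : Fin n) (y : EuclideanSpace ℝ (Fin n)) : ℝ :=
  ∑ j, g.riemannUp φ k j l j y

/-- The curvature scalar `R = gᵏˡ Rₖₗ`. -/
def scalarCurv (y : EuclideanSpace ℝ (Fin n)) : ℝ :=
  ∑ k, ∑ l, g.invMetric φ k l y * g.ricci φ k l y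

/-- The Weyl tensor `Cⱼₖₗₘ`. -/
def weyl (j k l m : Fin n) (y : EuclideanSpace ℝ (Fin n)) : ℝ :=
  g.riemann φ j k l m y
    + 1 / ((n : ℝ) - 2) *
      (g.metric φ j m y * g.ricci φ k l y - g.metric φ k m y * g.ricci φ j l y
        + g.ricci φ j m y * g.metric φ k l y - g.ricci φ k m y * g.metric φ j l y)
    - g.scalarCurv φ y *
      (g.metric φ j m y * g.metric φ k l y - g.metric φ j l y * g.metric φ k m y)
        / (((n : ℝ) - 1) * ((n : ℝ) - 2))

variable (X : (p : M) → TangentSpace (𝓡 n) p)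

/-- The covariant components `Xₖ = gₖⱼ Xʲ` of a vector field in the chart `φ`. -/
def vecLow (k : Fin n) (y : EuclideanSpace ℝ (Fin n)) : ℝ :=
  ∑ j, g.metric φ k j y * vecUp φ X j y

/-- The scalar `X² = Xₖ Xᵏ`. -/
def sqNorm (y : EuclideanSpace ℝ (Fin n)) : ℝ :=
  ∑ k, g.vecLow φ X k y * vecUp φ X k y

/-- The covariant derivative `∇ⱼ Xₖ = ∂ⱼ Xₖ - Γˡⱼₖ Xₗ`. -/
def covDeriv (j k : Fin n) (y : EuclideanSpace ℝ (Fin n)) : ℝ :=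
  partialD j (g.vecLow φ X k) y - ∑ l, g.christoffel φ l j k y * g.vecLow φ X l y

/-- `X` is a Chen vector of `g` on the set `U`, with scalar field `ρ`: a smooth time-like vector
field with `∇ⱼ Xₖ = ρ gⱼₖ` in every coordinate system. -/
structure IsChenVector (U : Set M) (X : (p : M) → TangentSpace (𝓡 n) p) (ρ : M → ℝ) : Prop where
  smooth_vec : ContMDiffOn (𝓡 n) (𝓡 n).tangent ∞
    (fun p ↦ (⟨p, X p⟩ : TangentBundle (𝓡 n) M)) U
  smooth_scalar : ContMDiffOn (𝓡 n) 𝓘(ℝ, ℝ) ∞ ρ U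
  timelike : ∀ p ∈ U, g.inner p (X p) (X p) < 0
  concircular : ∀ φ ∈ IsManifold.maximalAtlas (𝓡 n) ∞ M, ∀ y ∈ φ.target, φ.symm y ∈ U →
    ∀ j k : Fin n, g.covDeriv φ X j k y = ρ (φ.symm y) * g.metric φ j k y

/-- `(M, g)` is a generalized Robertson-Walker manifold: around every point there are coordinates
`(t, x)`, with `t` the coordinate of index `0`, in which
`ds² = - dt² + q(t)² g*_{μν}(x) dx^μ dx^ν`, with a smooth positive function `q` of `t` alone and
a Riemannian metric `g*` that depends on the space coordinates `x` alone. -/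
def IsGRW : Prop :=
  ∀ p : M, ∃ φ ∈ IsManifold.maximalAtlas (𝓡 n) ∞ M, p ∈ φ.source ∧
    ∃ (q : ℝ → ℝ) (h : ({i : Fin n // i ≠ 0} → ℝ) →
        Matrix {i : Fin n // i ≠ 0} {i : Fin n // i ≠ 0} ℝ),
      ContDiffOn ℝ ∞ q ((fun y : EuclideanSpace ℝ (Fin n) ↦ y 0) '' φ.target) ∧
      (∀ a b, ContDiffOn ℝ ∞ (fun x ↦ h x a b)
        ((fun (y : EuclideanSpace ℝ (Fin n)) (c : {i : Fin n // i ≠ 0}) ↦ y c) '' φ.target)) ∧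
      ∀ y ∈ φ.target,
        0 < q (y 0) ∧
        (h fun c ↦ y c).PosDef ∧
        g.metric φ 0 0 y = -1 ∧
        (∀ a : {i : Fin n // i ≠ 0}, g.metric φ 0 a y = 0 ∧ g.metric φ a 0 y = 0) ∧
        ∀ a b : {i : Fin n // i ≠ 0}, g.metric φ a b y = q (y 0) ^ 2 * h (fun c ↦ y c) a b

end LorentzMetric

end GRW

end

/-! Existence. In coordinates with `ds² = -dt² + q(t)² g*`, the field `X = q ∂ₜ` satisfies `∇ⱼXₖ =
q' gⱼₖ` and `X² = -q² < 0`. To have the equation in every chart, `2∇X` is written by Koszul's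
formula as a bilinear form `nablaForm` in the metric, the field and their first derivatives. It
contains no inverse metric, and `nablaForm_pullback` shows its invariance under coordinate changes.

Structure. Commuting derivatives in `∇ⱼXₖ = ρ gⱼₖ` gives `Rᵢⱼₖᵐ Xₘ = ∂ᵢρ gⱼₖ - ∂ⱼρ gᵢₖ`
(`sum_riemannUp_mul_vecLow`). Contracted with `Xᵏ`, the left side vanishes by antisymmetry, so `∂ᵢρ
= b Xᵢ` with `b = X(ρ)/X²`. Traced over `j, k`, it gives `Rᵢₘ Xᵐ = -(n-1) ∂ᵢρ = ξ Xᵢ` with `ξ =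
-(n-1) b`. As `∇X` is symmetric, the covector `Xᵢ` is closed; hence `d(b X) = d(dρ) = 0` forces
`∂ᵢb` to be a multiple of `Xᵢ`, and so is `∂ᵢξ`. Finally `Cⱼₖₗₘ XʲXᵐ` (`sum_weyl_mul`) is an
expression in `gₖₗ`, `XₖXₗ` and `Rₖₗ`, linear in `Rₖₗ`, which `ricci_eq` solves for `Rₖₗ`.

The symmetries of the curvature used on the way are derived in coordinates from the Christoffel
symbols. -/

open scoped Manifold ContDiff Bundle

noncomputable section

namespace GRW

/-! ### Vector fields and scalar fields read in charts -/

section Charts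

variable {n : ℕ} {M : Type*} [TopologicalSpace M]
  [ChartedSpace (EuclideanSpace ℝ (Fin n)) M] [IsManifold (𝓡 n) ∞ M]
  {φ ψ : OpenPartialHomeomorph M (EuclideanSpace ℝ (Fin n))}

omit [IsManifold (𝓡 n) ∞ M] in
theorem mdifferentiable_of_mem_maximalAtlas (hφ : φ ∈ IsManifold.maximalAtlas (𝓡 n) ∞ M) :
    φ.MDifferentiable (𝓡 n) (𝓡 n) :=
  ⟨(contMDiffOn_of_mem_maximalAtlas hφ).mdifferentiableOn (by simp),
    (contMDiffOn_symm_of_mem_maximalAtlas hφ).mdifferentiableOn (by simp)⟩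

/-- The vector field `X` read in the chart `φ`. -/
def chartVec (φ : OpenPartialHomeomorph M (EuclideanSpace ℝ (Fin n)))
    (X : (p : M) → TangentSpace (𝓡 n) p) (y : EuclideanSpace ℝ (Fin n)) :
    EuclideanSpace ℝ (Fin n) :=
  mfderiv (𝓡 n) (𝓡 n) φ (φ.symm y) (X (φ.symm y))

omit [IsManifold (𝓡 n) ∞ M] in
theorem vecUp_eq_chartVec (X : (p : M) → TangentSpace (𝓡 n) p) (i : Fin n)
    (y : EuclideanSpace ℝ (Fin n)) : vecUp φ X i y = chartVec φ X y i := rfl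

omit [IsManifold (𝓡 n) ∞ M] in
theorem mfderiv_symm_chartVec (hφ : φ ∈ IsManifold.maximalAtlas (𝓡 n) ∞ M)
    (X : (p : M) → TangentSpace (𝓡 n) p) {y : EuclideanSpace ℝ (Fin n)} (hy : y ∈ φ.target) :
    mfderiv (𝓡 n) (𝓡 n) φ.symm y (chartVec φ X y) = X (φ.symm y) := by
  have h := (mdifferentiable_of_mem_maximalAtlas hφ).symm_comp_deriv (φ.map_target hy)
  rw [φ.right_inv hy] at h
  exact DFunLike.congr_fun h (X (φ.symm y))

omit [IsManifold (𝓡 n) ∞ M] in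
theorem mfderiv_chart_mfderiv_symm (hφ : φ ∈ IsManifold.maximalAtlas (𝓡 n) ∞ M)
    {y : EuclideanSpace ℝ (Fin n)} (hy : y ∈ φ.target) (v : EuclideanSpace ℝ (Fin n)) :
    mfderiv (𝓡 n) (𝓡 n) φ (φ.symm y) (mfderiv (𝓡 n) (𝓡 n) φ.symm y v) = v :=
  DFunLike.congr_fun ((mdifferentiable_of_mem_maximalAtlas hφ).comp_symm_deriv hy) v

/-- Common source of the smoothness of coordinate fields, of chart components and of fields built
from components: each is the tangent map of a chart or of its inverse applied to a smooth section.
-/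
theorem contMDiffOn_tangentMap_comp {N N' N'' : Type*} [TopologicalSpace N]
    [ChartedSpace (EuclideanSpace ℝ (Fin n)) N] [IsManifold (𝓡 n) ∞ N] [TopologicalSpace N']
    [ChartedSpace (EuclideanSpace ℝ (Fin n)) N'] [IsManifold (𝓡 n) ∞ N'] [TopologicalSpace N'']
    [ChartedSpace (EuclideanSpace ℝ (Fin n)) N'']
    {f : N → N'} {s : Set N} (hs : IsOpen s) (hf : ContMDiffOn (𝓡 n) (𝓡 n) ∞ f s)
    {t : Set N''} {σ : N'' → TangentBundle (𝓡 n) N}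
    (hσ : ContMDiffOn (𝓡 n) (𝓡 n).tangent ∞ σ t) (hst : ∀ x ∈ t, (σ x).1 ∈ s) :
    ContMDiffOn (𝓡 n) (𝓡 n).tangent ∞ (fun x ↦ tangentMap (𝓡 n) (𝓡 n) f (σ x)) t := by
  have : IsManifold (𝓡 n) 1 N := IsManifold.of_le (n := ∞) (by simp)
  have : IsManifold (𝓡 n) 1 N' := IsManifold.of_le (n := ∞) (by simp)
  have h := hf.contMDiffOn_tangentMapWithin (m := ∞) (by simp) hs.uniqueMDiffOn
  refine (h.comp hσ hst).congr fun x hx ↦ ?_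
  simp only [tangentMap, tangentMapWithin, Function.comp]
  rw [mfderivWithin_of_isOpen hs (hst x hx)]

theorem contMDiffOn_coordVec (hφ : φ ∈ IsManifold.maximalAtlas (𝓡 n) ∞ M)
    (v : EuclideanSpace ℝ (Fin n)) :
    ContMDiffOn (𝓡 n) (𝓡 n).tangent ∞
      (fun y ↦ (⟨φ.symm y, mfderiv (𝓡 n) (𝓡 n) φ.symm y v⟩ : TangentBundle (𝓡 n) M))
      φ.target := by
  have hv : ContMDiffOn (𝓡 n) (𝓡 n).tangent ∞
      (fun y ↦ (⟨y, v⟩ : TangentBundle (𝓡 n) (EuclideanSpace ℝ (Fin n)))) φ.target :=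
    contMDiffOn_vectorSpace_iff_contDiffOn.2 contDiffOn_const
  exact contMDiffOn_tangentMap_comp φ.open_target (contMDiffOn_symm_of_mem_maximalAtlas hφ) hv
    fun y hy ↦ hy

theorem contDiffOn_chartVec (hφ : φ ∈ IsManifold.maximalAtlas (𝓡 n) ∞ M) {U : Set M}
    {X : (p : M) → TangentSpace (𝓡 n) p}
    (hX : ContMDiffOn (𝓡 n) (𝓡 n).tangent ∞ (fun p ↦ (⟨p, X p⟩ : TangentBundle (𝓡 n) M)) U) :
    ContDiffOn ℝ ∞ (chartVec φ X) (φ.target ∩ φ.symm ⁻¹' U) := by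
  have h1 : ContMDiffOn (𝓡 n) (𝓡 n).tangent ∞
      (fun y ↦ (⟨φ.symm y, X (φ.symm y)⟩ : TangentBundle (𝓡 n) M))
      (φ.target ∩ φ.symm ⁻¹' U) :=
    hX.comp ((contMDiffOn_symm_of_mem_maximalAtlas hφ).mono Set.inter_subset_left)
      Set.inter_subset_right
  have h2 := contMDiffOn_tangentMap_comp φ.open_source (contMDiffOn_of_mem_maximalAtlas hφ) h1
    fun y hy ↦ φ.map_target hy.1
  refine contMDiffOn_vectorSpace_iff_contDiffOn.1 (h2.congr fun y hy ↦ ?_)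
  simp only [tangentMap, chartVec]
  rw [φ.right_inv hy.1]

omit [IsManifold (𝓡 n) ∞ M] in
/-- The coordinate change from the chart `ψ` to the chart `φ` is smooth. -/
theorem contDiffOn_transition (hφ : φ ∈ IsManifold.maximalAtlas (𝓡 n) ∞ M)
    (hψ : ψ ∈ IsManifold.maximalAtlas (𝓡 n) ∞ M) :
    ContDiffOn ℝ ∞ (fun y ↦ φ (ψ.symm y)) (ψ.target ∩ ψ.symm ⁻¹' φ.source) := by
  refine contMDiffOn_iff_contDiffOn.1 ?_
  exact (contMDiffOn_of_mem_maximalAtlas hφ).comp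
    ((contMDiffOn_symm_of_mem_maximalAtlas hψ).mono Set.inter_subset_left) Set.inter_subset_right

omit [IsManifold (𝓡 n) ∞ M] in
theorem fderiv_transition (hφ : φ ∈ IsManifold.maximalAtlas (𝓡 n) ∞ M)
    (hψ : ψ ∈ IsManifold.maximalAtlas (𝓡 n) ∞ M) {y : EuclideanSpace ℝ (Fin n)}
    (hy : y ∈ ψ.target) (hy' : ψ.symm y ∈ φ.source) (v : EuclideanSpace ℝ (Fin n)) :
    fderiv ℝ (fun z ↦ φ (ψ.symm z)) y v =
      mfderiv (𝓡 n) (𝓡 n) φ (ψ.symm y) (mfderiv (𝓡 n) (𝓡 n) ψ.symm y v) := by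
  have h := mfderiv_comp (I := 𝓡 n) (I' := 𝓡 n) (I'' := 𝓡 n) y
    ((mdifferentiable_of_mem_maximalAtlas hφ).mdifferentiableAt hy')
    ((mdifferentiable_of_mem_maximalAtlas hψ).mdifferentiableAt_symm hy)
  have h2 := DFunLike.congr_fun h v
  rw [← mfderiv_eq_fderiv]
  exact h2

omit [ChartedSpace (EuclideanSpace ℝ (Fin n)) M] [IsManifold (𝓡 n) ∞ M] in
theorem isOpen_target_inter (φ : OpenPartialHomeomorph M (EuclideanSpace ℝ (Fin n))) {U : Set M}
    (hU : IsOpen U) : IsOpen (φ.target ∩ φ.symm ⁻¹' U) :=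
  φ.isOpen_inter_preimage_symm hU

omit [IsManifold (𝓡 n) ∞ M] in
theorem chartVec_transition (hφ : φ ∈ IsManifold.maximalAtlas (𝓡 n) ∞ M)
    (hψ : ψ ∈ IsManifold.maximalAtlas (𝓡 n) ∞ M) (X : (p : M) → TangentSpace (𝓡 n) p)
    {y : EuclideanSpace ℝ (Fin n)} (hy : y ∈ ψ.target) (hy' : ψ.symm y ∈ φ.source) :
    chartVec φ X (φ (ψ.symm y)) = fderiv ℝ (fun z ↦ φ (ψ.symm z)) y (chartVec ψ X y) := by
  rw [fderiv_transition hφ hψ hy hy', mfderiv_symm_chartVec hψ X hy, chartVec,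
    φ.left_inv hy']

/-- Makes scalars that are defined without charts, such as `X(ρ)/X²`, smooth on `U` from their
coordinate expressions. -/
theorem contMDiffOn_of_chart {U : Set M} (hU : IsOpen U) {f : M → ℝ}
    (h : ∀ φ ∈ IsManifold.maximalAtlas (𝓡 n) ∞ M,
      ContDiffOn ℝ ∞ (fun y ↦ f (φ.symm y)) (φ.target ∩ φ.symm ⁻¹' U)) :
    ContMDiffOn (𝓡 n) 𝓘(ℝ, ℝ) ∞ f U := by
  intro p hp
  set φ := chartAt (EuclideanSpace ℝ (Fin n)) p
  have hφ : φ ∈ IsManifold.maximalAtlas (𝓡 n) ∞ M := IsManifold.chart_mem_maximalAtlas p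
  have hs : p ∈ φ.source := mem_chart_source _ p
  have h1 : ContMDiffAt (𝓡 n) 𝓘(ℝ, ℝ) ∞ (fun y ↦ f (φ.symm y)) (φ p) :=
    (contMDiffOn_iff_contDiffOn.2 (h φ hφ)).contMDiffAt
      ((isOpen_target_inter φ hU).mem_nhds ⟨φ.map_source hs, by simpa [φ.left_inv hs] using hp⟩)
  have h2 := h1.comp p ((contMDiffOn_of_mem_maximalAtlas hφ).contMDiffAt
    (φ.open_source.mem_nhds hs))
  refine (h2.congr_of_eventuallyEq ?_).contMDiffWithinAt
  filter_upwards [φ.open_source.mem_nhds hs] with q hq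
  simp [φ.left_inv hq]

omit [IsManifold (𝓡 n) ∞ M] in
theorem contDiffOn_of_contMDiffOn (hφ : φ ∈ IsManifold.maximalAtlas (𝓡 n) ∞ M) {U : Set M}
    {f : M → ℝ} (hf : ContMDiffOn (𝓡 n) 𝓘(ℝ, ℝ) ∞ f U) :
    ContDiffOn ℝ ∞ (fun y ↦ f (φ.symm y)) (φ.target ∩ φ.symm ⁻¹' U) :=
  contMDiffOn_iff_contDiffOn.1 (hf.comp
    ((contMDiffOn_symm_of_mem_maximalAtlas hφ).mono Set.inter_subset_left) Set.inter_subset_right)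

/-- The derivative `X f` of a scalar field along a vector field. -/
def dirDeriv (X : (p : M) → TangentSpace (𝓡 n) p) (f : M → ℝ) (p : M) : ℝ :=
  mfderiv (𝓡 n) 𝓘(ℝ, ℝ) f p (X p)

omit [IsManifold (𝓡 n) ∞ M] in
theorem dirDeriv_eq_fderiv (hφ : φ ∈ IsManifold.maximalAtlas (𝓡 n) ∞ M)
    {f : M → ℝ} (X : (p : M) → TangentSpace (𝓡 n) p) {y : EuclideanSpace ℝ (Fin n)}
    (hy : y ∈ φ.target) (hf : MDifferentiableAt (𝓡 n) 𝓘(ℝ, ℝ) f (φ.symm y)) :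
    dirDeriv X f (φ.symm y) =
      fderiv ℝ (fun z ↦ f (φ.symm z)) y (chartVec φ X y) := by
  have h := mfderiv_comp (I := 𝓡 n) (I' := 𝓡 n) (I'' := 𝓘(ℝ, ℝ)) y hf
    ((mdifferentiable_of_mem_maximalAtlas hφ).mdifferentiableAt_symm hy)
  have h2 := DFunLike.congr_fun h (chartVec φ X y)
  rw [← mfderiv_eq_fderiv]
  refine Eq.trans ?_ h2.symm
  exact congrArg (mfderiv (𝓡 n) 𝓘(ℝ, ℝ) f (φ.symm y)) (mfderiv_symm_chartVec hφ X hy).symm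

end Charts

/-! ### The metric in a chart: smoothness, nondegeneracy, change of chart -/

namespace LorentzMetric

variable {n : ℕ} [NeZero n] {M : Type*} [TopologicalSpace M]
  [ChartedSpace (EuclideanSpace ℝ (Fin n)) M] [IsManifold (𝓡 n) ∞ M]
  {φ ψ : OpenPartialHomeomorph M (EuclideanSpace ℝ (Fin n))} (g : LorentzMetric n M)

/-- The metric read in the chart `φ`, as a bilinear form on the coordinate space. -/
def chartForm (φ : OpenPartialHomeomorph M (EuclideanSpace ℝ (Fin n)))
    (y : EuclideanSpace ℝ (Fin n)) :
    EuclideanSpace ℝ (Fin n) →L[ℝ] EuclideanSpace ℝ (Fin n) →L[ℝ] ℝ :=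
  (LinearMap.mk₂ ℝ
    (fun u v : EuclideanSpace ℝ (Fin n) ↦ g.inner (φ.symm y) (mfderiv (𝓡 n) (𝓡 n) φ.symm y u)
      (mfderiv (𝓡 n) (𝓡 n) φ.symm y v))
    (fun u u' v ↦ by
      erw [map_add, map_add]
      rfl)
    (fun c u v ↦ by
      erw [map_smul, map_smul]
      rfl)
    (fun u v v' ↦ by
      erw [map_add, map_add])
    (fun c u v ↦ by
      erw [map_smul, map_smul])).toContinuousBilinearMap

theorem chartForm_apply (y u v : EuclideanSpace ℝ (Fin n)) :
    g.chartForm φ y u v = g.inner (φ.symm y) (mfderiv (𝓡 n) (𝓡 n) φ.symm y u)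
      (mfderiv (𝓡 n) (𝓡 n) φ.symm y v) := rfl

theorem metric_eq_chartForm (i j : Fin n) (y : EuclideanSpace ℝ (Fin n)) :
    g.metric φ i j y =
      g.chartForm φ y (EuclideanSpace.single i 1) (EuclideanSpace.single j 1) := rfl

theorem chartForm_symm (y u v : EuclideanSpace ℝ (Fin n)) :
    g.chartForm φ y u v = g.chartForm φ y v u := by
  rw [chartForm_apply, chartForm_apply, g.symm]

/-- In finite dimension it suffices to test on constant vectors `u`, `v`; the value is then the
bundle metric applied to two smooth sections along `φ.symm`. -/
theorem contDiffOn_chartForm (hφ : φ ∈ IsManifold.maximalAtlas (𝓡 n) ∞ M) :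
    ContDiffOn ℝ ∞ (g.chartForm φ) φ.target := by
  refine contDiffOn_clm_apply.2 fun u ↦ contDiffOn_clm_apply.2 fun v ↦ ?_
  have h : ContMDiffOn (𝓡 n) ((𝓡 n).prod 𝓘(ℝ)) ∞
      (fun y ↦ Bundle.TotalSpace.mk' ℝ (E := Bundle.Trivial M ℝ) (φ.symm y)
        (g.inner (φ.symm y) (mfderiv (𝓡 n) (𝓡 n) φ.symm y u)
          (mfderiv (𝓡 n) (𝓡 n) φ.symm y v))) φ.target := by
    apply ContMDiffOn.clm_bundle_apply₂ (F₁ := EuclideanSpace ℝ (Fin n))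
      (F₂ := EuclideanSpace ℝ (Fin n)) (E₁ := fun p : M ↦ TangentSpace (𝓡 n) p)
      (E₂ := fun p : M ↦ TangentSpace (𝓡 n) p)
    · exact g.contMDiff.comp_contMDiffOn (contMDiffOn_symm_of_mem_maximalAtlas hφ)
    · exact contMDiffOn_coordVec hφ u
    · exact contMDiffOn_coordVec hφ v
  intro y hy
  have h2 := h y hy
  simp only [Bundle.contMDiffWithinAt_totalSpace] at h2
  exact contMDiffWithinAt_iff_contDiffWithinAt.1 h2.2

/-- Pairing `v` with the `j`-th vector of an orthonormal basis returns its `j`-th coordinate up to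
sign. -/
theorem inner_eq_zero_of_forall {p : M} {v : TangentSpace (𝓡 n) p}
    (h : ∀ w, g.inner p v w = 0) : v = 0 := by
  obtain ⟨b, hb⟩ := g.lorentzian p
  refine b.ext_elem fun j ↦ ?_
  have h1 := h (b j)
  rw [← b.sum_repr v] at h1
  simp only [map_sum, map_smul, sum_apply, smul_apply,
    hb, smul_eq_mul, mul_ite, mul_zero, Finset.sum_ite_eq', Finset.mem_univ, if_true] at h1
  split_ifs at h1 <;> simpa using h1

theorem chartForm_nondegenerate (hφ : φ ∈ IsManifold.maximalAtlas (𝓡 n) ∞ M)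
    {y v : EuclideanSpace ℝ (Fin n)} (hy : y ∈ φ.target)
    (h : ∀ w, g.chartForm φ y v w = 0) : v = 0 := by
  have h0 : mfderiv (𝓡 n) (𝓡 n) φ.symm y v = 0 := by
    refine g.inner_eq_zero_of_forall fun w ↦ ?_
    -- All tangent spaces are definitionally the model space, so `w` extends to a constant family to
    -- which `chartVec` applies.
    have hw := mfderiv_symm_chartVec hφ (fun q ↦ (w : EuclideanSpace ℝ (Fin n))) hy
    have := h (chartVec φ (fun q ↦ (w : EuclideanSpace ℝ (Fin n))) y)
    rw [chartForm_apply, hw] at this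
    exact this
  have := mfderiv_chart_mfderiv_symm hφ hy v
  rw [h0] at this
  exact this.symm.trans (map_zero _)

theorem chartForm_transition (hφ : φ ∈ IsManifold.maximalAtlas (𝓡 n) ∞ M)
    (hψ : ψ ∈ IsManifold.maximalAtlas (𝓡 n) ∞ M) {y : EuclideanSpace ℝ (Fin n)}
    (hy : y ∈ ψ.target) (hy' : ψ.symm y ∈ φ.source) (u v : EuclideanSpace ℝ (Fin n)) :
    g.chartForm ψ y u v = g.chartForm φ (φ (ψ.symm y))
      (fderiv ℝ (fun z ↦ φ (ψ.symm z)) y u) (fderiv ℝ (fun z ↦ φ (ψ.symm z)) y v) := by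
  have h : ∀ w, mfderiv (𝓡 n) (𝓡 n) φ.symm (φ (ψ.symm y))
      (mfderiv (𝓡 n) (𝓡 n) φ (ψ.symm y) w) = w := fun w ↦ DFunLike.congr_fun
    ((mdifferentiable_of_mem_maximalAtlas hφ).symm_comp_deriv hy') w
  -- The two forms live over the propositionally equal points `ψ.symm y` and `φ.symm (φ (ψ.symm
  -- y))`; this moves the base point with the vectors held fixed.
  have h2 : ∀ (a b : EuclideanSpace ℝ (Fin n)) (q : M), ψ.symm y = q →
      g.inner (ψ.symm y) a b = g.inner q a b := by
    rintro a b _ rfl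
    rfl
  rw [fderiv_transition hφ hψ hy hy', fderiv_transition hφ hψ hy hy']
  refine (h2 _ _ _ (φ.left_inv hy').symm).trans ?_
  exact (congrArg₂ (fun a b : EuclideanSpace ℝ (Fin n) ↦ g.inner (φ.symm (φ (ψ.symm y))) a b)
    (h _) (h _)).symm

theorem chartForm_chartVec (hφ : φ ∈ IsManifold.maximalAtlas (𝓡 n) ∞ M)
    (X : (p : M) → TangentSpace (𝓡 n) p) {y : EuclideanSpace ℝ (Fin n)} (hy : y ∈ φ.target) :
    g.chartForm φ y (chartVec φ X y) (chartVec φ X y) =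
      g.inner (φ.symm y) (X (φ.symm y)) (X (φ.symm y)) := by
  rw [chartForm_apply, mfderiv_symm_chartVec hφ X hy]

end LorentzMetric

/-! ### Calculus of partial derivatives -/

section PartialDerivatives

variable {n : ℕ} {f h : EuclideanSpace ℝ (Fin n) → ℝ} {y : EuclideanSpace ℝ (Fin n)}

theorem partialD_add (i : Fin n) (hf : ContDiffAt ℝ ∞ f y) (hh : ContDiffAt ℝ ∞ h y) :
    partialD i (fun z ↦ f z + h z) y = partialD i f y + partialD i h y := by
  simp only [partialD]
  rw [fderiv_fun_add (hf.differentiableAt (by simp)) (hh.differentiableAt (by simp))]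
  rfl

theorem partialD_mul (i : Fin n) (hf : ContDiffAt ℝ ∞ f y) (hh : ContDiffAt ℝ ∞ h y) :
    partialD i (fun z ↦ f z * h z) y = f y * partialD i h y + partialD i f y * h y := by
  simp only [partialD]
  rw [fderiv_fun_mul (hf.differentiableAt (by simp)) (hh.differentiableAt (by simp))]
  simp [mul_comm]

theorem partialD_const_mul (i : Fin n) (c : ℝ) (hf : ContDiffAt ℝ ∞ f y) :
    partialD i (fun z ↦ c * f z) y = c * partialD i f y := by
  simp only [partialD]
  rw [fderiv_const_mul (hf.differentiableAt (by simp))]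
  simp

theorem partialD_sum {ι : Type*} (s : Finset ι) {F : ι → EuclideanSpace ℝ (Fin n) → ℝ} (i : Fin n)
    (hF : ∀ a ∈ s, ContDiffAt ℝ ∞ (F a) y) :
    partialD i (fun z ↦ ∑ a ∈ s, F a z) y = ∑ a ∈ s, partialD i (F a) y := by
  simp only [partialD]
  rw [fderiv_fun_sum fun a ha ↦ (hF a ha).differentiableAt (by simp)]
  simp

theorem partialD_congr (i : Fin n) (hfh : ∀ᶠ z in nhds y, f z = h z) :
    partialD i f y = partialD i h y := by
  simp only [partialD]
  rw [Filter.EventuallyEq.fderiv_eq hfh]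

theorem contDiffAt_partialD (i : Fin n) (hf : ContDiffAt ℝ ∞ f y) :
    ContDiffAt ℝ ∞ (partialD i f) y :=
  (hf.fderiv_right (m := ∞) (by simp)).clm_apply contDiffAt_const

theorem partialD_comm (i j : Fin n) (hf : ContDiffAt ℝ ∞ f y) :
    partialD i (partialD j f) y = partialD j (partialD i f) y := by
  have hd : DifferentiableAt ℝ (fderiv ℝ f) y :=
    (hf.fderiv_right (m := ∞) (by simp)).differentiableAt (by simp)
  have key : ∀ a b : Fin n, partialD a (partialD b f) y =
      fderiv ℝ (fderiv ℝ f) y (EuclideanSpace.single a 1) (EuclideanSpace.single b 1) := by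
    intro a b
    have hb : partialD b f = fun z ↦ fderiv ℝ f z (EuclideanSpace.single b 1) := rfl
    rw [partialD, hb, fderiv_clm_apply hd (by fun_prop)]
    simp
  rw [key, key]
  exact (hf.isSymmSndFDerivAt (by
    simpa using WithTop.coe_le_coe.2 (le_top : (2 : ℕ∞) ≤ ⊤))).eq _ _

theorem sum_smul_single (v : EuclideanSpace ℝ (Fin n)) :
    ∑ i, v i • EuclideanSpace.single i (1 : ℝ) = v := by
  ext j
  simp [Finset.sum_apply, Pi.single_apply]

theorem bilinear_eq_sum (B : EuclideanSpace ℝ (Fin n) →L[ℝ] EuclideanSpace ℝ (Fin n) →L[ℝ] ℝ)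
    (u v : EuclideanSpace ℝ (Fin n)) :
    B u v = ∑ i, ∑ j, u i * v j *
      B (EuclideanSpace.single i 1) (EuclideanSpace.single j 1) := by
  conv_lhs => rw [← sum_smul_single u, ← sum_smul_single v]
  simp [Finset.mul_sum, sum_apply, mul_assoc, mul_left_comm]
  exact Finset.sum_comm

theorem fderiv_eq_sum_partialD (v : EuclideanSpace ℝ (Fin n)) :
    fderiv ℝ f y v = ∑ i, v i * partialD i f y := by
  conv_lhs => rw [← sum_smul_single v]
  simp [partialD]

end PartialDerivatives

/-! ### Christoffel symbols and the symmetries of the curvature -/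

namespace LorentzMetric

variable {n : ℕ} [NeZero n] {M : Type*} [TopologicalSpace M]
  [ChartedSpace (EuclideanSpace ℝ (Fin n)) M] [IsManifold (𝓡 n) ∞ M]
  {φ : OpenPartialHomeomorph M (EuclideanSpace ℝ (Fin n))} (g : LorentzMetric n M)

theorem chartForm_eq_sum (y u v : EuclideanSpace ℝ (Fin n)) :
    g.chartForm φ y u v = ∑ i, ∑ j, u i * v j * g.metric φ i j y :=
  bilinear_eq_sum _ u v

theorem metric_symm (i j : Fin n) (y : EuclideanSpace ℝ (Fin n)) :
    g.metric φ i j y = g.metric φ j i y := by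
  rw [metric_eq_chartForm, chartForm_symm, metric_eq_chartForm]

theorem invMetric_symm (i j : Fin n) (y : EuclideanSpace ℝ (Fin n)) :
    g.invMetric φ i j y = g.invMetric φ j i y := by
  have h : (Matrix.of fun a b : Fin n ↦ g.metric φ a b y).IsSymm :=
    Matrix.IsSymm.ext fun a b ↦ g.metric_symm b a y
  have h2 : (Matrix.of fun a b : Fin n ↦ g.metric φ a b y)⁻¹.IsSymm := by
    rw [Matrix.IsSymm, Matrix.transpose_nonsing_inv, h.eq]
  exact h2.apply j i

/-- A kernel vector of the matrix would be orthogonal to everything, against nondegeneracy. -/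
theorem det_metric_ne_zero (hφ : φ ∈ IsManifold.maximalAtlas (𝓡 n) ∞ M)
    {y : EuclideanSpace ℝ (Fin n)} (hy : y ∈ φ.target) :
    (Matrix.of fun a b : Fin n ↦ g.metric φ a b y).det ≠ 0 := by
  intro h
  obtain ⟨v, hv, hv'⟩ := Matrix.exists_mulVec_eq_zero_iff.2 h
  refine hv ?_
  have h0 : WithLp.toLp 2 v = 0 := by
    refine g.chartForm_nondegenerate hφ hy fun w ↦ ?_
    rw [chartForm_symm, chartForm_eq_sum]
    refine Finset.sum_eq_zero fun i _ ↦ ?_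
    have := congrFun hv' i
    simp only [Matrix.mulVec, dotProduct, Matrix.of_apply, Pi.zero_apply] at this
    calc ∑ j, w i * v j * g.metric φ i j y = w i * ∑ j, g.metric φ i j y * v j := by
          rw [Finset.mul_sum]
          exact Finset.sum_congr rfl fun j _ ↦ by ring
      _ = 0 := by rw [this, mul_zero]
  simpa using h0

theorem sum_metric_mul_invMetric (hφ : φ ∈ IsManifold.maximalAtlas (𝓡 n) ∞ M)
    {y : EuclideanSpace ℝ (Fin n)} (hy : y ∈ φ.target) (i j : Fin n) :
    ∑ l, g.metric φ i l y * g.invMetric φ l j y = if i = j then 1 else 0 := by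
  have h := Matrix.mul_nonsing_inv _ (g.det_metric_ne_zero hφ hy).isUnit
  have h2 := congrFun (congrFun h i) j
  rwa [Matrix.mul_apply, Matrix.one_apply] at h2

section Smooth

variable (hφ : φ ∈ IsManifold.maximalAtlas (𝓡 n) ∞ M)
  {y : EuclideanSpace ℝ (Fin n)} (hy : y ∈ φ.target)
include hφ hy

theorem contDiffAt_metric (i j : Fin n) : ContDiffAt ℝ ∞ (g.metric φ i j) y :=
  (((g.contDiffOn_chartForm hφ).contDiffAt (φ.open_target.mem_nhds hy)).clm_apply
    contDiffAt_const).clm_apply contDiffAt_const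

theorem contDiffAt_invMetric (i j : Fin n) : ContDiffAt ℝ ∞ (g.invMetric φ i j) y := by
  have hdet : ∀ F : Fin n → Fin n → EuclideanSpace ℝ (Fin n) → ℝ,
      (∀ a b, ContDiffAt ℝ ∞ (F a b) y) →
      ContDiffAt ℝ ∞ (fun z ↦ (Matrix.of fun a b ↦ F a b z).det) y := by
    intro F hF
    simp only [Matrix.det_apply', Matrix.of_apply]
    exact ContDiffAt.sum fun σ _ ↦ contDiffAt_const.mul (contDiffAt_prod fun a _ ↦ hF _ _)
  -- Cramer's rule: the cofactor is the determinant with row `j` replaced by the `i`-th unit vector,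
  -- so every entry is polynomial in the metric up to division by the determinant.
  have h : g.invMetric φ i j = fun z ↦ (Matrix.of fun a b ↦ g.metric φ a b z).det⁻¹ *
      (Matrix.of fun a b ↦ if a = j then (if b = i then 1 else 0) else g.metric φ a b z).det := by
    funext z
    rw [invMetric, Matrix.inv_def, Matrix.smul_apply, Matrix.adjugate_apply, Ring.inverse_eq_inv',
      smul_eq_mul]
    congr 2
    ext a b
    by_cases hab : a = j <;> simp [Matrix.updateRow_apply, hab, Pi.single_apply]
  rw [h]
  refine ((hdet _ fun a b ↦ g.contDiffAt_metric hφ hy a b).inv (g.det_metric_ne_zero hφ hy)).mul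
    (hdet (fun a b z ↦ if a = j then (if b = i then 1 else 0) else g.metric φ a b z) fun a b ↦ ?_)
  by_cases hab : a = j
  · simp only [hab, if_true]
    exact contDiffAt_const
  · simp only [hab, if_false]
    exact g.contDiffAt_metric hφ hy a b

theorem contDiffAt_christoffel (k i j : Fin n) : ContDiffAt ℝ ∞ (g.christoffel φ k i j) y :=
  contDiffAt_const.mul (ContDiffAt.sum fun l _ ↦ (g.contDiffAt_invMetric hφ hy k l).mul
    (((contDiffAt_partialD i (g.contDiffAt_metric hφ hy l j)).add
      (contDiffAt_partialD j (g.contDiffAt_metric hφ hy l i))).sub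
      (contDiffAt_partialD l (g.contDiffAt_metric hφ hy i j))))

end Smooth

theorem christoffel_symm (k i j : Fin n) :
    g.christoffel φ k i j = g.christoffel φ k j i := by
  funext y
  have h : g.metric φ i j = g.metric φ j i := funext fun z ↦ g.metric_symm i j z
  simp only [christoffel, h]
  congr 1
  exact Finset.sum_congr rfl fun l _ ↦ by ring

section Curvature

variable (hφ : φ ∈ IsManifold.maximalAtlas (𝓡 n) ∞ M)
  {y : EuclideanSpace ℝ (Fin n)} (hy : y ∈ φ.target)
include hφ hy

theorem sum_mul_metric_mul_invMetric (a : Fin n → ℝ) (k : Fin n) :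
    ∑ s, (∑ l, g.invMetric φ s l y * a l) * g.metric φ s k y = a k := by
  calc ∑ s, (∑ l, g.invMetric φ s l y * a l) * g.metric φ s k y
      = ∑ l, a l * ∑ s, g.metric φ k s y * g.invMetric φ s l y := by
        simp only [Finset.sum_mul, Finset.mul_sum]
        rw [Finset.sum_comm]
        refine Finset.sum_congr rfl fun l _ ↦ Finset.sum_congr rfl fun s _ ↦ ?_
        rw [g.metric_symm s k]
        ring
    _ = a k := by simp [g.sum_metric_mul_invMetric hφ hy]

theorem sum_christoffel_mul_metric (i j k : Fin n) :
    ∑ s, g.christoffel φ s i j y * g.metric φ s k y = (1 / 2) *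
      (partialD i (g.metric φ k j) y + partialD j (g.metric φ k i) y
        - partialD k (g.metric φ i j) y) := by
  rw [← g.sum_mul_metric_mul_invMetric hφ hy (fun k ↦ partialD i (g.metric φ k j) y +
    partialD j (g.metric φ k i) y - partialD k (g.metric φ i j) y) k, Finset.mul_sum]
  refine Finset.sum_congr rfl fun s _ ↦ ?_
  rw [christoffel]
  ring

/-- The Levi-Civita connection is compatible with the metric. -/
theorem partialD_metric (i k m : Fin n) :
    partialD i (g.metric φ k m) y = ∑ s, g.christoffel φ s i k y * g.metric φ s m y
      + ∑ s, g.christoffel φ s i m y * g.metric φ s k y := by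
  have h : ∀ a b, g.metric φ a b = g.metric φ b a := fun a b ↦ funext fun z ↦ g.metric_symm a b z
  rw [g.sum_christoffel_mul_metric hφ hy, g.sum_christoffel_mul_metric hφ hy, h m k, h m i, h k i]
  ring

/-- Metric compatibility is used twice. Antisymmetrised in `i, j`, the right side becomes `Rᵢⱼₖₘ +
Rᵢⱼₘₖ` up to sign. -/
theorem partialD_partialD_metric (i j k m : Fin n) :
    partialD i (partialD j (g.metric φ k m)) y =
      ∑ s, partialD i (g.christoffel φ s j k) y * g.metric φ s m y
      + ∑ s, ∑ t, g.christoffel φ s j k y * g.christoffel φ t i s y * g.metric φ t m y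
      + ∑ s, ∑ t, g.christoffel φ s j k y * g.christoffel φ t i m y * g.metric φ t s y
      + ∑ s, partialD i (g.christoffel φ s j m) y * g.metric φ s k y
      + ∑ s, ∑ t, g.christoffel φ s j m y * g.christoffel φ t i s y * g.metric φ t k y
      + ∑ s, ∑ t, g.christoffel φ s j m y * g.christoffel φ t i k y * g.metric φ t s y := by
  have hev : ∀ᶠ z in nhds y, partialD j (g.metric φ k m) z =
      ∑ s, g.christoffel φ s j k z * g.metric φ s m z
      + ∑ s, g.christoffel φ s j m z * g.metric φ s k z := by
    filter_upwards [φ.open_target.mem_nhds hy] with z hz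
    exact g.partialD_metric hφ hz j k m
  have hs : ∀ a b s, ContDiffAt ℝ ∞
      (fun z ↦ g.christoffel φ s j a z * g.metric φ s b z) y := fun a b s ↦
    (g.contDiffAt_christoffel hφ hy s j a).mul (g.contDiffAt_metric hφ hy s b)
  have hone : ∀ a b, partialD i (fun z ↦ ∑ s, g.christoffel φ s j a z * g.metric φ s b z) y =
      ∑ s, partialD i (g.christoffel φ s j a) y * g.metric φ s b y
      + ∑ s, ∑ t, g.christoffel φ s j a y * g.christoffel φ t i s y * g.metric φ t b y
      + ∑ s, ∑ t, g.christoffel φ s j a y * g.christoffel φ t i b y * g.metric φ t s y := by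
    intro a b
    rw [partialD_sum _ _ fun s _ ↦ hs a b s, ← Finset.sum_add_distrib, ← Finset.sum_add_distrib]
    refine Finset.sum_congr rfl fun s _ ↦ ?_
    rw [partialD_mul i (g.contDiffAt_christoffel hφ hy s j a) (g.contDiffAt_metric hφ hy s b),
      g.partialD_metric hφ hy]
    simp only [mul_add, Finset.mul_sum, mul_assoc]
    ring
  rw [partialD_congr i hev, partialD_add i (ContDiffAt.sum fun s _ ↦ hs k m s)
    (ContDiffAt.sum fun s _ ↦ hs m k s), hone, hone]
  ring

omit hφ hy in
theorem riemann_eq (i j k m : Fin n) : g.riemann φ i j k m y =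
    ∑ s, partialD j (g.christoffel φ s i k) y * g.metric φ s m y
    - ∑ s, partialD i (g.christoffel φ s j k) y * g.metric φ s m y
    + ∑ s, ∑ t, g.christoffel φ s i k y * g.christoffel φ t j s y * g.metric φ t m y
    - ∑ s, ∑ t, g.christoffel φ s j k y * g.christoffel φ t i s y * g.metric φ t m y := by
  have hc : ∀ a b, ∑ s, ∑ t, g.christoffel φ s a k y * g.christoffel φ t b s y * g.metric φ t m y =
      ∑ s, (∑ t, g.christoffel φ t a k y * g.christoffel φ s b t y) * g.metric φ s m y := by
    intro a b
    rw [Finset.sum_comm]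
    simp only [Finset.sum_mul]
  rw [hc, hc, ← Finset.sum_sub_distrib, ← Finset.sum_add_distrib, ← Finset.sum_sub_distrib, riemann]
  refine Finset.sum_congr rfl fun s _ ↦ ?_
  rw [riemannUp, Finset.sum_sub_distrib]
  ring

theorem riemann_antisymm_right (i j k m : Fin n) :
    g.riemann φ i j k m y = - g.riemann φ i j m k y := by
  have h := partialD_comm i j (g.contDiffAt_metric hφ hy k m)
  rw [g.partialD_partialD_metric hφ hy, g.partialD_partialD_metric hφ hy] at h
  -- The crossed products of Christoffel symbols, one carrying `k` and the other `m`, are exchanged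
  -- by `i ↔ j` and drop out of the commutator.
  have hQ : ∀ i j k m : Fin n,
      ∑ s, ∑ t, g.christoffel φ s i k y * g.christoffel φ t j m y * g.metric φ t s y =
      ∑ s, ∑ t, g.christoffel φ s j m y * g.christoffel φ t i k y * g.metric φ t s y := by
    intro i j k m
    rw [Finset.sum_comm]
    refine Finset.sum_congr rfl fun s _ ↦ Finset.sum_congr rfl fun t _ ↦ ?_
    rw [g.metric_symm s t]
    ring
  rw [riemann_eq, riemann_eq]
  linarith [hQ i j k m, hQ i j m k]

omit hφ hy in
theorem riemannUp_antisymm_left (i j k m : Fin n) :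
    g.riemannUp φ i j k m y = - g.riemannUp φ j i k m y := by
  simp only [riemannUp, Finset.sum_sub_distrib]
  ring

omit hφ hy in
/-- The first Bianchi identity. -/
theorem riemannUp_cyclic (i j k m : Fin n) :
    g.riemannUp φ i j k m y + g.riemannUp φ j k i m y + g.riemannUp φ k i j m y = 0 := by
  simp only [riemannUp, Finset.sum_sub_distrib]
  rw [g.christoffel_symm m i k, g.christoffel_symm m j i, g.christoffel_symm m k j]
  simp only [g.christoffel_symm _ i k, g.christoffel_symm _ j i, g.christoffel_symm _ k j]
  ring

theorem riemannUp_eq_sum_riemann (i j k m : Fin n) :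
    g.riemannUp φ i j k m y = ∑ s, g.riemann φ i j k s y * g.invMetric φ s m y := by
  simp only [riemann, Finset.sum_mul]
  rw [Finset.sum_comm]
  calc g.riemannUp φ i j k m y
      = ∑ t, g.riemannUp φ i j k t y * ∑ s, g.metric φ t s y * g.invMetric φ s m y := by
        simp [g.sum_metric_mul_invMetric hφ hy]
    _ = _ := by simp only [Finset.mul_sum, mul_assoc]

/-- The trace pairs a tensor antisymmetric in its last two indices with the symmetric inverse
metric. -/
theorem sum_riemannUp_trace (i j : Fin n) : ∑ k, g.riemannUp φ i j k k y = 0 := by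
  have h : ∑ k, g.riemannUp φ i j k k y = - ∑ k, g.riemannUp φ i j k k y := by
    simp only [g.riemannUp_eq_sum_riemann hφ hy]
    conv_rhs => rw [Finset.sum_comm]
    simp only [← Finset.sum_neg_distrib]
    refine Finset.sum_congr rfl fun k _ ↦ Finset.sum_congr rfl fun s _ ↦ ?_
    rw [g.riemann_antisymm_right hφ hy, g.invMetric_symm]
    ring
  linarith

/-- Trace of the first Bianchi identity, whose third term vanishes by `sum_riemannUp_trace`. -/
theorem ricci_symm (k l : Fin n) : g.ricci φ k l y = g.ricci φ l k y := by
  have h : ∑ j, (g.riemannUp φ k j l j y + g.riemannUp φ j l k j y + g.riemannUp φ l k j j y) = 0 :=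
    Finset.sum_eq_zero fun j _ ↦ g.riemannUp_cyclic k j l j
  rw [Finset.sum_add_distrib, Finset.sum_add_distrib, g.sum_riemannUp_trace hφ hy] at h
  have h2 : ∑ j, g.riemannUp φ j l k j y = - ∑ j, g.riemannUp φ l j k j y := by
    rw [← Finset.sum_neg_distrib]
    exact Finset.sum_congr rfl fun j _ ↦ g.riemannUp_antisymm_left j l k j
  rw [ricci, ricci]
  linarith

end Curvature


/-! ### Chen vectors: Ricci identity, eigenvector equation, Weyl contraction -/

variable {n : ℕ} [NeZero n] {M : Type*} [TopologicalSpace M]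
  [ChartedSpace (EuclideanSpace ℝ (Fin n)) M] [IsManifold (𝓡 n) ∞ M]
  {φ : OpenPartialHomeomorph M (EuclideanSpace ℝ (Fin n))} {g : LorentzMetric n M}

theorem sqNorm_eq_inner (hφ : φ ∈ IsManifold.maximalAtlas (𝓡 n) ∞ M)
    (X : (p : M) → TangentSpace (𝓡 n) p) {y : EuclideanSpace ℝ (Fin n)} (hy : y ∈ φ.target) :
    g.sqNorm φ X y = g.inner (φ.symm y) (X (φ.symm y)) (X (φ.symm y)) := by
  rw [← g.chartForm_chartVec hφ X hy, chartForm_eq_sum]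
  simp only [sqNorm, vecLow, vecUp_eq_chartVec, Finset.sum_mul]
  refine Finset.sum_congr rfl fun i _ ↦ Finset.sum_congr rfl fun j _ ↦ ?_
  ring

namespace IsChenVector

variable {U : Set M} {X : (p : M) → TangentSpace (𝓡 n) p} {ρ : M → ℝ}
  (hX : g.IsChenVector U X ρ) (hU : IsOpen U)
  (hφ : φ ∈ IsManifold.maximalAtlas (𝓡 n) ∞ M)
  {y : EuclideanSpace ℝ (Fin n)} (hy : y ∈ φ.target) (hyU : φ.symm y ∈ U)

include hX hφ hy hyU

theorem sqNorm_ne_zero : g.sqNorm φ X y ≠ 0 := by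
  rw [sqNorm_eq_inner hφ X hy]
  exact (hX.timelike _ hyU).ne

theorem partialD_vecLow (j k : Fin n) : partialD j (g.vecLow φ X k) y =
    ∑ l, g.christoffel φ l j k y * g.vecLow φ X l y + ρ (φ.symm y) * g.metric φ j k y := by
  have := hX.concircular φ hφ y hy hyU j k
  rw [covDeriv] at this
  linarith

/-- The covector `Xₖ` is closed, since both `Γˡⱼₖ` and `ρ gⱼₖ` are symmetric in `j, k`. -/
theorem partialD_vecLow_comm (j k : Fin n) :
    partialD j (g.vecLow φ X k) y = partialD k (g.vecLow φ X j) y := by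
  rw [hX.partialD_vecLow hφ hy hyU, hX.partialD_vecLow hφ hy hyU, g.metric_symm]
  simp only [g.christoffel_symm _ j k]

include hU

theorem contDiffAt_vecUp (i : Fin n) : ContDiffAt ℝ ∞ (vecUp φ X i) y := by
  have h : ContDiffAt ℝ ∞ (chartVec φ X) y := (contDiffOn_chartVec hφ hX.smooth_vec).contDiffAt
    ((isOpen_target_inter φ hU).mem_nhds ⟨hy, hyU⟩)
  exact contDiffAt_euclidean.1 h i

theorem contDiffAt_vecLow (i : Fin n) : ContDiffAt ℝ ∞ (g.vecLow φ X i) y :=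
  ContDiffAt.sum fun j _ ↦ (g.contDiffAt_metric hφ hy i j).mul
    (hX.contDiffAt_vecUp hU hφ hy hyU j)

theorem contDiffAt_sqNorm : ContDiffAt ℝ ∞ (g.sqNorm φ X) y :=
  ContDiffAt.sum fun j _ ↦ (hX.contDiffAt_vecLow hU hφ hy hyU j).mul
    (hX.contDiffAt_vecUp hU hφ hy hyU j)

omit hX [NeZero n] [IsManifold (𝓡 n) ∞ M] in
theorem contDiffAt_scalar {f : M → ℝ} (hf : ContMDiffOn (𝓡 n) 𝓘(ℝ, ℝ) ∞ f U) :
    ContDiffAt ℝ ∞ (fun z ↦ f (φ.symm z)) y :=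
  (contDiffOn_of_contMDiffOn hφ hf).contDiffAt
    ((isOpen_target_inter φ hU).mem_nhds ⟨hy, hyU⟩)

/-- The Chen equation is differentiated and then substituted back, so that no derivative of `X`
remains on the right. -/
theorem partialD_partialD_vecLow (i j k : Fin n) :
    partialD i (partialD j (g.vecLow φ X k)) y =
      ∑ l, partialD i (g.christoffel φ l j k) y * g.vecLow φ X l y
      + ∑ l, ∑ m, g.christoffel φ l j k y * g.christoffel φ m i l y * g.vecLow φ X m y
      + ρ (φ.symm y) * ∑ l, g.christoffel φ l j k y * g.metric φ l i y
      + partialD i (fun z ↦ ρ (φ.symm z)) y * g.metric φ j k y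
      + ρ (φ.symm y) * (∑ l, g.christoffel φ l i j y * g.metric φ l k y
        + ∑ l, g.christoffel φ l i k y * g.metric φ l j y) := by
  have hev : ∀ᶠ z in nhds y, partialD j (g.vecLow φ X k) z =
      ∑ l, g.christoffel φ l j k z * g.vecLow φ X l z + ρ (φ.symm z) * g.metric φ j k z := by
    filter_upwards [(isOpen_target_inter φ hU).mem_nhds ⟨hy, hyU⟩] with z hz
    exact hX.partialD_vecLow hφ hz.1 hz.2 j k
  have hs : ∀ l, ContDiffAt ℝ ∞ (fun z ↦ g.christoffel φ l j k z * g.vecLow φ X l z) y := fun l ↦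
    (g.contDiffAt_christoffel hφ hy l j k).mul (hX.contDiffAt_vecLow hU hφ hy hyU l)
  have hρ := contDiffAt_scalar hU hφ hy hyU hX.smooth_scalar
  rw [partialD_congr i hev, partialD_add i (ContDiffAt.sum fun l _ ↦ hs l)
    (hρ.mul (g.contDiffAt_metric hφ hy j k)), partialD_mul i hρ (g.contDiffAt_metric hφ hy j k),
    partialD_sum _ _ fun l _ ↦ hs l, g.partialD_metric hφ hy]
  have : ∑ l, partialD i (fun z ↦ g.christoffel φ l j k z * g.vecLow φ X l z) y =
      ∑ l, partialD i (g.christoffel φ l j k) y * g.vecLow φ X l y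
      + ∑ l, ∑ m, g.christoffel φ l j k y * g.christoffel φ m i l y * g.vecLow φ X m y
      + ρ (φ.symm y) * ∑ l, g.christoffel φ l j k y * g.metric φ l i y := by
    rw [Finset.mul_sum, ← Finset.sum_add_distrib, ← Finset.sum_add_distrib]
    refine Finset.sum_congr rfl fun l _ ↦ ?_
    rw [partialD_mul i (g.contDiffAt_christoffel hφ hy l j k)
      (hX.contDiffAt_vecLow hU hφ hy hyU l), hX.partialD_vecLow hφ hy hyU, g.metric_symm i l]
    simp only [mul_add, Finset.mul_sum, mul_assoc]
    ring
  rw [this]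
  ring

/-- The Ricci identity for a Chen vector. -/
theorem sum_riemannUp_mul_vecLow (i j k : Fin n) :
    ∑ m, g.riemannUp φ i j k m y * g.vecLow φ X m y =
      partialD i (fun z ↦ ρ (φ.symm z)) y * g.metric φ j k y
      - partialD j (fun z ↦ ρ (φ.symm z)) y * g.metric φ i k y := by
  have h := partialD_comm i j (hX.contDiffAt_vecLow hU hφ hy hyU k)
  rw [hX.partialD_partialD_vecLow hU hφ hy hyU, hX.partialD_partialD_vecLow hU hφ hy hyU] at h
  have hc : ∀ a b, ∑ l, ∑ m, g.christoffel φ l a k y * g.christoffel φ m b l y *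
      g.vecLow φ X m y =
      ∑ m, (∑ l, g.christoffel φ l a k y * g.christoffel φ m b l y) * g.vecLow φ X m y := by
    intro a b
    rw [Finset.sum_comm]
    simp only [Finset.sum_mul]
  have hR : ∑ m, g.riemannUp φ i j k m y * g.vecLow φ X m y =
      ∑ m, partialD j (g.christoffel φ m i k) y * g.vecLow φ X m y
      - ∑ m, partialD i (g.christoffel φ m j k) y * g.vecLow φ X m y
      + ∑ l, ∑ m, g.christoffel φ l i k y * g.christoffel φ m j l y * g.vecLow φ X m y
      - ∑ l, ∑ m, g.christoffel φ l j k y * g.christoffel φ m i l y * g.vecLow φ X m y := by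
    rw [hc, hc, ← Finset.sum_sub_distrib, ← Finset.sum_add_distrib, ← Finset.sum_sub_distrib]
    refine Finset.sum_congr rfl fun s _ ↦ ?_
    rw [riemannUp, Finset.sum_sub_distrib]
    ring
  -- Of the terms carrying an undifferentiated `ρ`, two are exchanged by `i ↔ j`; this third one is
  -- symmetric because the connection is torsion-free.
  have hs : ∑ l, g.christoffel φ l i j y * g.metric φ l k y =
      ∑ l, g.christoffel φ l j i y * g.metric φ l k y := by
    simp only [g.christoffel_symm _ i j]
  rw [hR]
  linear_combination ρ (φ.symm y) * hs - h

theorem sum_riemann_mul_vecUp (i j k : Fin n) :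
    ∑ m, g.riemann φ i j k m y * vecUp φ X m y =
      partialD i (fun z ↦ ρ (φ.symm z)) y * g.metric φ j k y
      - partialD j (fun z ↦ ρ (φ.symm z)) y * g.metric φ i k y := by
  rw [← hX.sum_riemannUp_mul_vecLow hU hφ hy hyU]
  simp only [riemann, vecLow, Finset.sum_mul, Finset.mul_sum, mul_assoc]
  exact Finset.sum_comm

/-- Contract the Ricci identity with `Xᵏ`: antisymmetry in `k, m` kills `Rᵢⱼₖₘ XᵏXᵐ`. -/
theorem partialD_scalar_mul_vecLow_comm (i j : Fin n) :
    partialD i (fun z ↦ ρ (φ.symm z)) y * g.vecLow φ X j y =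
      partialD j (fun z ↦ ρ (φ.symm z)) y * g.vecLow φ X i y := by
  have h0 : ∑ k, vecUp φ X k y * ∑ m, g.riemann φ i j k m y * vecUp φ X m y = 0 := by
    have h : ∑ k, vecUp φ X k y * ∑ m, g.riemann φ i j k m y * vecUp φ X m y =
        - ∑ k, vecUp φ X k y * ∑ m, g.riemann φ i j k m y * vecUp φ X m y := by
      simp only [Finset.mul_sum]
      conv_rhs => rw [Finset.sum_comm]
      simp only [← Finset.sum_neg_distrib]
      refine Finset.sum_congr rfl fun k _ ↦ Finset.sum_congr rfl fun m _ ↦ ?_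
      rw [g.riemann_antisymm_right hφ hy]
      ring
    linarith
  simp only [hX.sum_riemann_mul_vecUp hU hφ hy hyU] at h0
  rw [← sub_eq_zero, ← h0]
  simp only [vecLow, Finset.mul_sum, ← Finset.sum_sub_distrib]
  exact Finset.sum_congr rfl fun k _ ↦ by ring

/-- Trace of the Ricci identity over `j, k`: the first term yields `n ∂ᵢρ`, the second removes one
`∂ᵢρ`, and the sign comes from exchanging the last two indices of the Riemann tensor. -/
theorem sum_ricci_mul_vecUp_eq_partialD (i : Fin n) :
    ∑ m, g.ricci φ i m y * vecUp φ X m y =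
      -((n : ℝ) - 1) * partialD i (fun z ↦ ρ (φ.symm z)) y := by
  have h1 : ∑ m, g.ricci φ i m y * vecUp φ X m y =
      - ∑ j, ∑ k, (∑ m, g.riemann φ i j k m y * vecUp φ X m y) * g.invMetric φ k j y := by
    simp only [ricci, g.riemannUp_eq_sum_riemann hφ hy, Finset.sum_mul, ← Finset.sum_neg_distrib]
    rw [Finset.sum_comm]
    refine Finset.sum_congr rfl fun j _ ↦ ?_
    rw [Finset.sum_comm]
    refine Finset.sum_congr rfl fun k _ ↦ Finset.sum_congr rfl fun m _ ↦ ?_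
    rw [g.riemann_antisymm_right hφ hy]
    ring
  simp only [hX.sum_riemann_mul_vecUp hU hφ hy hyU, sub_mul, mul_assoc, Finset.sum_sub_distrib,
    ← Finset.mul_sum, g.sum_metric_mul_invMetric hφ hy] at h1
  rw [h1]
  simp
  ring

/-- Contract `∂ᵢρ Xₖ = ∂ₖρ Xᵢ` with `Xᵏ` and divide by `X² ≠ 0`. -/
theorem partialD_scalar_eq (i : Fin n) :
    partialD i (fun z ↦ ρ (φ.symm z)) y =
      (∑ k, vecUp φ X k y * partialD k (fun z ↦ ρ (φ.symm z)) y) / g.sqNorm φ X y *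
        g.vecLow φ X i y := by
  have h0 := hX.sqNorm_ne_zero hφ hy hyU
  field_simp
  rw [sqNorm, Finset.mul_sum, Finset.sum_mul]
  refine Finset.sum_congr rfl fun k _ ↦ ?_
  linear_combination vecUp φ X k y * hX.partialD_scalar_mul_vecLow_comm hU hφ hy hyU i k

omit hU in
/-- A scalar field `f` with `∂ᵢρ = f Xᵢ` near a point has a gradient proportional to `X` there. -/
theorem partialD_eq_of_partialD_eq (hρ : ContDiffAt ℝ ∞ (fun z ↦ ρ (φ.symm z)) y)
    (hlow : ∀ i, ContDiffAt ℝ ∞ (g.vecLow φ X i) y)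
    {f : EuclideanSpace ℝ (Fin n) → ℝ} (hf : ContDiffAt ℝ ∞ f y)
    (h : ∀ᶠ z in nhds y, ∀ i, partialD i (fun z ↦ ρ (φ.symm z)) z = f z * g.vecLow φ X i z)
    (i : Fin n) :
    partialD i f y =
      (∑ k, vecUp φ X k y * partialD k f y) / g.sqNorm φ X y * g.vecLow φ X i y := by
  have key : ∀ j, partialD j f y * g.vecLow φ X i y = partialD i f y * g.vecLow φ X j y := by
    intro j
    have hc := partialD_comm i j hρ
    -- With `∂ⱼρ = f Xⱼ` near `y`, the equality of mixed derivatives reads `∂ᵢ(f Xⱼ) = ∂ⱼ(f Xᵢ)`;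
    -- closedness of `X` cancels the terms in which `X` is differentiated.
    rw [partialD_congr i (h.mono fun z hz ↦ hz j), partialD_congr j (h.mono fun z hz ↦ hz i),
      partialD_mul i hf (hlow j), partialD_mul j hf (hlow i),
      hX.partialD_vecLow_comm hφ hy hyU i j] at hc
    linarith
  have h0 := hX.sqNorm_ne_zero hφ hy hyU
  field_simp
  rw [sqNorm, Finset.mul_sum, Finset.sum_mul]
  refine Finset.sum_congr rfl fun k _ ↦ ?_
  linear_combination -vecUp φ X k y * key k

theorem contDiffAt_dirDeriv {f : M → ℝ} (hf : ContMDiffOn (𝓡 n) 𝓘(ℝ, ℝ) ∞ f U) :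
    ContDiffAt ℝ ∞
      (fun z ↦ ∑ k, vecUp φ X k z * partialD k (fun w ↦ f (φ.symm w)) z) y :=
  ContDiffAt.sum fun k _ ↦ (hX.contDiffAt_vecUp hU hφ hy hyU k).mul
    (contDiffAt_partialD k (contDiffAt_scalar hU hφ hy hyU hf))

omit hX [NeZero n] [IsManifold (𝓡 n) ∞ M] in
theorem dirDeriv_eq_sum {f : M → ℝ} (hf : ContMDiffOn (𝓡 n) 𝓘(ℝ, ℝ) ∞ f U) :
    dirDeriv X f (φ.symm y) =
      ∑ k, vecUp φ X k y * partialD k (fun w ↦ f (φ.symm w)) y := by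
  rw [dirDeriv_eq_fderiv hφ X hy ((hf.contMDiffAt (hU.mem_nhds hyU)).mdifferentiableAt (by simp)),
    fderiv_eq_sum_partialD]
  rfl

-- The quotient is written without coordinates, so it is one function on `M`. It is needed for `f =
-- ρ` and then for the resulting quotient itself.
omit hy hyU hφ in
theorem contMDiffOn_dirDeriv_div {f : M → ℝ} (hf : ContMDiffOn (𝓡 n) 𝓘(ℝ, ℝ) ∞ f U) :
    ContMDiffOn (𝓡 n) 𝓘(ℝ, ℝ) ∞ (fun p ↦ dirDeriv X f p / g.inner p (X p) (X p)) U := by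
  refine contMDiffOn_of_chart hU fun φ hφ ↦ ?_
  have h : ContDiffOn ℝ ∞ (fun z ↦ (∑ k, vecUp φ X k z * partialD k (fun w ↦ f (φ.symm w)) z) /
      g.sqNorm φ X z) (φ.target ∩ φ.symm ⁻¹' U) := fun z hz ↦
    ((hX.contDiffAt_dirDeriv hU hφ hz.1 hz.2 hf).div (hX.contDiffAt_sqNorm hU hφ hz.1 hz.2)
      (hX.sqNorm_ne_zero hφ hz.1 hz.2)).contDiffWithinAt
  refine h.congr fun z hz ↦ ?_
  rw [dirDeriv_eq_sum hU hφ hz.1 hz.2 hf, sqNorm_eq_inner hφ X hz.1]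

theorem partialD_scalar_eq_dirDeriv (i : Fin n) :
    partialD i (fun z ↦ ρ (φ.symm z)) y =
      dirDeriv X ρ (φ.symm y) / g.inner (φ.symm y) (X (φ.symm y)) (X (φ.symm y)) *
        g.vecLow φ X i y := by
  rw [hX.partialD_scalar_eq hU hφ hy hyU, dirDeriv_eq_sum hU hφ hy hyU hX.smooth_scalar,
    sqNorm_eq_inner hφ X hy]

/-- Contraction of the Weyl tensor with a Chen vector. -/
theorem sum_weyl_mul {b ξ : ℝ} (hξ : ξ = -((n : ℝ) - 1) * b)
    (hb : ∀ i, partialD i (fun z ↦ ρ (φ.symm z)) y = b * g.vecLow φ X i y) (k l : Fin n) :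
    ∑ j, ∑ m, g.weyl φ j k l m y * (vecUp φ X j y * vecUp φ X m y / g.sqNorm φ X y) =
      (b * (g.sqNorm φ X y * g.metric φ k l y - g.vecLow φ X k y * g.vecLow φ X l y)
      + 1 / ((n : ℝ) - 2) * (g.sqNorm φ X y * g.ricci φ k l y
        - 2 * ξ * g.vecLow φ X k y * g.vecLow φ X l y + ξ * g.sqNorm φ X y * g.metric φ k l y)
      - g.scalarCurv φ y * (g.sqNorm φ X y * g.metric φ k l y
        - g.vecLow φ X k y * g.vecLow φ X l y) / (((n : ℝ) - 1) * ((n : ℝ) - 2))) /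
      g.sqNorm φ X y := by
  have hric : ∀ i, ∑ m, g.ricci φ i m y * vecUp φ X m y = ξ * g.vecLow φ X i y := by
    intro i
    rw [hX.sum_ricci_mul_vecUp_eq_partialD hU hφ hy hyU, hb, hξ]
    ring
  have hlow : ∀ i, ∑ m, g.metric φ i m y * vecUp φ X m y = g.vecLow φ X i y := fun i ↦ rfl
  -- First of two contractions. The symmetric tensors are written with indices `l j`, so that
  -- summing over `j` next again matches `hlow` and `hric`.
  have hm : ∀ j, ∑ m, g.weyl φ j k l m y * vecUp φ X m y =
      b * (g.vecLow φ X j y * g.metric φ k l y - g.vecLow φ X k y * g.metric φ l j y)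
      + 1 / ((n : ℝ) - 2) * (g.vecLow φ X j y * g.ricci φ k l y
        - g.vecLow φ X k y * g.ricci φ l j y + ξ * g.vecLow φ X j y * g.metric φ k l y
        - ξ * g.vecLow φ X k y * g.metric φ l j y)
      - g.scalarCurv φ y * (g.vecLow φ X j y * g.metric φ k l y
        - g.metric φ l j y * g.vecLow φ X k y) / (((n : ℝ) - 1) * ((n : ℝ) - 2)) := by
    intro j
    have h1 := hX.sum_riemann_mul_vecUp hU hφ hy hyU j k l
    rw [hb, hb] at h1
    have h2 : ∑ m, g.weyl φ j k l m y * vecUp φ X m y =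
        ∑ m, g.riemann φ j k l m y * vecUp φ X m y
        + 1 / ((n : ℝ) - 2) * ((∑ m, g.metric φ j m y * vecUp φ X m y) * g.ricci φ k l y
          - (∑ m, g.metric φ k m y * vecUp φ X m y) * g.ricci φ j l y
          + (∑ m, g.ricci φ j m y * vecUp φ X m y) * g.metric φ k l y
          - (∑ m, g.ricci φ k m y * vecUp φ X m y) * g.metric φ j l y)
        - g.scalarCurv φ y * ((∑ m, g.metric φ j m y * vecUp φ X m y) * g.metric φ k l y
          - g.metric φ j l y * ∑ m, g.metric φ k m y * vecUp φ X m y)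
          / (((n : ℝ) - 1) * ((n : ℝ) - 2)) := by
      simp only [Finset.sum_mul, Finset.mul_sum, ← Finset.sum_add_distrib,
        ← Finset.sum_sub_distrib, Finset.sum_div]
      refine Finset.sum_congr rfl fun m _ ↦ ?_
      rw [weyl]
      ring
    rw [h2, h1, hlow, hlow, hric, hric, g.metric_symm j l, g.ricci_symm hφ hy j l]
    ring
  have h3 : ∑ j, ∑ m, g.weyl φ j k l m y * (vecUp φ X j y * vecUp φ X m y / g.sqNorm φ X y) =
      (∑ j, (∑ m, g.weyl φ j k l m y * vecUp φ X m y) * vecUp φ X j y) / g.sqNorm φ X y := by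
    simp only [Finset.sum_mul, Finset.sum_div]
    exact Finset.sum_congr rfl fun j _ ↦ Finset.sum_congr rfl fun m _ ↦ by ring
  have h4 : ∑ j, (∑ m, g.weyl φ j k l m y * vecUp φ X m y) * vecUp φ X j y =
      b * ((∑ j, g.vecLow φ X j y * vecUp φ X j y) * g.metric φ k l y
        - g.vecLow φ X k y * ∑ j, g.metric φ l j y * vecUp φ X j y)
      + 1 / ((n : ℝ) - 2) * ((∑ j, g.vecLow φ X j y * vecUp φ X j y) * g.ricci φ k l y
        - g.vecLow φ X k y * (∑ j, g.ricci φ l j y * vecUp φ X j y)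
        + ξ * (∑ j, g.vecLow φ X j y * vecUp φ X j y) * g.metric φ k l y
        - ξ * g.vecLow φ X k y * ∑ j, g.metric φ l j y * vecUp φ X j y)
      - g.scalarCurv φ y * ((∑ j, g.vecLow φ X j y * vecUp φ X j y) * g.metric φ k l y
        - (∑ j, g.metric φ l j y * vecUp φ X j y) * g.vecLow φ X k y)
        / (((n : ℝ) - 1) * ((n : ℝ) - 2)) := by
    simp only [Finset.sum_mul, Finset.mul_sum, ← Finset.sum_add_distrib,
      ← Finset.sum_sub_distrib, Finset.sum_div]
    refine Finset.sum_congr rfl fun j _ ↦ ?_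
    rw [← Finset.sum_mul, hm j]
    ring
  rw [h3, h4, hlow, hric, ← sqNorm]
  ring

/-- In the Weyl contraction divided by `X²`, `Rₖₗ` has coefficient `1/(n-2)`; inserting `ξ = -(n-1)
b` and solving gives the formula, `n ≥ 3` keeping `n-1` and `n-2` nonzero. -/
theorem ricci_eq (hn : 3 ≤ n) {b ξ : ℝ} (hξ : ξ = -((n : ℝ) - 1) * b)
    (hb : ∀ i, partialD i (fun z ↦ ρ (φ.symm z)) y = b * g.vecLow φ X i y) (k l : Fin n) :
    g.ricci φ k l y
      = ((n : ℝ) - 2) * (∑ j, ∑ m, g.weyl φ j k l m y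
          * (vecUp φ X j y * vecUp φ X m y / g.sqNorm φ X y))
        + (g.scalarCurv φ y - ξ) / ((n : ℝ) - 1)
          * (g.metric φ k l y - g.vecLow φ X k y * g.vecLow φ X l y / g.sqNorm φ X y)
        + ξ * (g.vecLow φ X k y * g.vecLow φ X l y / g.sqNorm φ X y) := by
  have hn' : (3 : ℝ) ≤ n := by exact_mod_cast hn
  have h1 : (n : ℝ) - 1 ≠ 0 := by linarith
  have h2 : (n : ℝ) - 2 ≠ 0 := by linarith
  have h0 := hX.sqNorm_ne_zero hφ hy hyU
  rw [hX.sum_weyl_mul hU hφ hy hyU hξ hb, hξ]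
  field_simp
  ring

end IsChenVector

theorem IsChenVector.exists_ricci_eq (hn : 3 ≤ n) {U : Set M}
    {X : (p : M) → TangentSpace (𝓡 n) p} {ρ : M → ℝ} (hU : IsOpen U)
    (hX : g.IsChenVector U X ρ) :
    ∃ ξ θ : M → ℝ,
      ContMDiffOn (𝓡 n) 𝓘(ℝ, ℝ) ∞ ξ U ∧ ContMDiffOn (𝓡 n) 𝓘(ℝ, ℝ) ∞ θ U ∧
      ∀ φ ∈ IsManifold.maximalAtlas (𝓡 n) ∞ M, ∀ y ∈ φ.target, φ.symm y ∈ U →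
        (∀ j, ∑ m, g.ricci φ j m y * vecUp φ X m y = ξ (φ.symm y) * g.vecLow φ X j y) ∧
        (ξ (φ.symm y) = -((n : ℝ) - 1)
          * (∑ k, vecUp φ X k y * partialD k (fun z ↦ ρ (φ.symm z)) y) / g.sqNorm φ X y) ∧
        (∀ i, partialD i (fun z ↦ ξ (φ.symm z)) y = θ (φ.symm y) * g.vecLow φ X i y) ∧
        (∀ k l, g.ricci φ k l y
          = ((n : ℝ) - 2) * (∑ j, ∑ m, g.weyl φ j k l m y
              * (vecUp φ X j y * vecUp φ X m y / g.sqNorm φ X y))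
            + (g.scalarCurv φ y - ξ (φ.symm y)) / ((n : ℝ) - 1)
              * (g.metric φ k l y - g.vecLow φ X k y * g.vecLow φ X l y / g.sqNorm φ X y)
            + ξ (φ.symm y) * (g.vecLow φ X k y * g.vecLow φ X l y / g.sqNorm φ X y)) := by
  -- Here `∂ᵢρ = b Xᵢ` and, with `c` below, `∂ᵢb = c Xᵢ`; hence `ξ = -(n-1) b` and `θ = -(n-1) c`.
  set b : M → ℝ := fun p ↦ dirDeriv X ρ p / g.inner p (X p) (X p) with hbdef
  have hbs : ContMDiffOn (𝓡 n) 𝓘(ℝ, ℝ) ∞ b U := hX.contMDiffOn_dirDeriv_div hU hX.smooth_scalar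
  set c : M → ℝ := fun p ↦ dirDeriv X b p / g.inner p (X p) (X p) with hcdef
  have hcs : ContMDiffOn (𝓡 n) 𝓘(ℝ, ℝ) ∞ c U := hX.contMDiffOn_dirDeriv_div hU hbs
  refine ⟨fun p ↦ -((n : ℝ) - 1) * b p, fun p ↦ -((n : ℝ) - 1) * c p,
    contMDiffOn_const.mul hbs, contMDiffOn_const.mul hcs, fun φ hφ y hy hyU ↦ ?_⟩
  have hb : ∀ z ∈ φ.target, φ.symm z ∈ U → ∀ i,
      partialD i (fun z ↦ ρ (φ.symm z)) z = b (φ.symm z) * g.vecLow φ X i z :=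
    fun z hz hzU i ↦ hX.partialD_scalar_eq_dirDeriv hU hφ hz hzU i
  refine ⟨fun j ↦ ?_, ?_, fun i ↦ ?_, fun k l ↦ hX.ricci_eq hU hφ hy hyU hn rfl (hb y hy hyU) k l⟩
  · rw [hX.sum_ricci_mul_vecUp_eq_partialD hU hφ hy hyU, hb y hy hyU]
    ring
  · simp only [hbdef]
    rw [dirDeriv_eq_sum hU hφ hy hyU hX.smooth_scalar, sqNorm_eq_inner hφ X hy, mul_div_assoc]
  · have hbc := contDiffAt_scalar hU hφ hy hyU hbs
    rw [partialD_const_mul i _ hbc,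
      hX.partialD_eq_of_partialD_eq hφ hy hyU (contDiffAt_scalar hU hφ hy hyU hX.smooth_scalar)
        (hX.contDiffAt_vecLow hU hφ hy hyU) hbc ?_ i]
    · simp only [hcdef]
      rw [dirDeriv_eq_sum hU hφ hy hyU hbs, sqNorm_eq_inner hφ X hy, mul_assoc]
    · filter_upwards [(isOpen_target_inter φ hU).mem_nhds ⟨hy, hyU⟩] with z hz
      exact hb z hz.1 hz.2

end LorentzMetric

/-! ### Koszul's formula and its invariance under coordinate changes -/

section CovariantDerivative

variable {E : Type*} [NormedAddCommGroup E] [NormedSpace ℝ E]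

/-- Twice the covariant derivative of the vector field `W` with respect to the metric `G`, as the
bilinear form `2 G(D_u W, v) + (D_u G)(W, v) - (D_v G)(W, u) + (D_W G)(u, v)`. -/
def nablaForm (G : E → E →L[ℝ] E →L[ℝ] ℝ) (W : E → E) (y : E) : E →L[ℝ] E →L[ℝ] ℝ :=
  (2 : ℝ) • (G y).comp (fderiv ℝ W y) + (fderiv ℝ G y).flip (W y)
    - ((fderiv ℝ G y).flip (W y)).flip + fderiv ℝ G y (W y)

theorem nablaForm_apply (G : E → E →L[ℝ] E →L[ℝ] ℝ) (W : E → E) (y u v : E) :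
    nablaForm G W y u v = 2 * G y (fderiv ℝ W y u) v + fderiv ℝ G y u (W y) v
      - fderiv ℝ G y v (W y) u + fderiv ℝ G y (W y) u v := by
  rfl

theorem fderiv_form_apply {G : E → E →L[ℝ] E →L[ℝ] ℝ} {y : E} (hG : DifferentiableAt ℝ G y)
    (w a b : E) : fderiv ℝ (fun z ↦ G z a b) y w = fderiv ℝ G y w a b := by
  have h := (hG.hasFDerivAt.clm_apply (hasFDerivAt_const a y)).clm_apply (hasFDerivAt_const b y)
  rw [h.fderiv]
  simp

set_option synthInstance.maxHeartbeats 200000 in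
/-- The covariant derivative is compatible with changes of coordinates. -/
theorem nablaForm_pullback {G G' : E → E →L[ℝ] E →L[ℝ] ℝ} {W W' τ : E → E} {y : E}
    (hτ : ContDiffAt ℝ ∞ τ y) (hsymmG : ∀ a b, G' (τ y) a b = G' (τ y) b a) (hG : DifferentiableAt ℝ G y) (hG' : DifferentiableAt ℝ G' (τ y))
    (hW : DifferentiableAt ℝ W y) (hW' : DifferentiableAt ℝ W' (τ y))
    (hGG' : ∀ᶠ z in nhds y, ∀ u v, G z u v = G' (τ z) (fderiv ℝ τ z u) (fderiv ℝ τ z v))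
    (hWW' : ∀ᶠ z in nhds y, W' (τ z) = fderiv ℝ τ z (W z)) (u v : E) :
    nablaForm G W y u v = nablaForm G' W' (τ y) (fderiv ℝ τ y u) (fderiv ℝ τ y v) := by
  have hτ1 : HasFDerivAt τ (fderiv ℝ τ y) y := (hτ.differentiableAt (by simp)).hasFDerivAt
  have hτ2 : HasFDerivAt (fderiv ℝ τ) (fderiv ℝ (fderiv ℝ τ) y) y :=
    ((hτ.fderiv_right (m := ∞) (by simp)).differentiableAt (by simp)).hasFDerivAt
  have hsymm : ∀ a b, fderiv ℝ (fderiv ℝ τ) y a b = fderiv ℝ (fderiv ℝ τ) y b a :=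
    fun a b ↦ (hτ.isSymmSndFDerivAt (by
      simpa using WithTop.coe_le_coe.2 (le_top : (2 : ℕ∞) ≤ ⊤))).eq a b
  -- Differentiating `G = τ*G'` produces second derivatives of `τ` in both arguments, besides the
  -- pulled-back derivative of `G'`.
  have hDG : ∀ w a b, fderiv ℝ G y w a b =
      fderiv ℝ G' (τ y) (fderiv ℝ τ y w) (fderiv ℝ τ y a) (fderiv ℝ τ y b)
      + G' (τ y) (fderiv ℝ (fderiv ℝ τ) y w a) (fderiv ℝ τ y b)
      + G' (τ y) (fderiv ℝ τ y a) (fderiv ℝ (fderiv ℝ τ) y w b) := by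
    intro w a b
    have h1 : HasFDerivAt (fun z ↦ G' (τ z)) ((fderiv ℝ G' (τ y)).comp (fderiv ℝ τ y)) y :=
      HasFDerivAt.comp (g := G') (f := τ) y hG'.hasFDerivAt hτ1
    have h2 := (h1.clm_apply (hτ2.clm_apply (hasFDerivAt_const a y))).clm_apply
      (hτ2.clm_apply (hasFDerivAt_const b y))
    rw [← fderiv_form_apply hG, Filter.EventuallyEq.fderiv_eq (hGG'.mono fun z hz ↦ hz a b),
      h2.fderiv]
    simp
    ring
  have hDW : ∀ w, fderiv ℝ W' (τ y) (fderiv ℝ τ y w) =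
      fderiv ℝ (fderiv ℝ τ) y w (W y) + fderiv ℝ τ y (fderiv ℝ W y w) := by
    intro w
    have h1 : HasFDerivAt (fun z ↦ W' (τ z)) ((fderiv ℝ W' (τ y)).comp (fderiv ℝ τ y)) y :=
      hW'.hasFDerivAt.comp y hτ1
    have h2 := hτ2.clm_apply hW.hasFDerivAt
    have h3 := h1.unique (h2.congr_of_eventuallyEq hWW')
    have h4 := DFunLike.congr_fun h3 w
    simp only [ContinuousLinearMap.comp_apply, add_apply, ContinuousLinearMap.flip_apply] at h4
    rw [h4, add_comm]
  simp only [nablaForm_apply, hDG, hDW, hWW'.self_of_nhds, hGG'.self_of_nhds, map_add, add_apply]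
  -- By symmetry of `D²τ` and of `G'`, the second-derivative terms on the left add up to `2
  -- G'(D²τ(u, W), Dτ v)`, which is what `hDW` contributes on the right.
  rw [hsymm v (W y), hsymm v u, hsymm u (W y)]
  linarith [hsymmG (fderiv ℝ τ y u) (fderiv ℝ (fderiv ℝ τ) y (W y) v),
    hsymmG (fderiv ℝ τ y v) (fderiv ℝ (fderiv ℝ τ) y (W y) u)]

end CovariantDerivative

/-! ### The concircular equation in different charts -/

namespace LorentzMetric

variable {n : ℕ} [NeZero n] {M : Type*} [TopologicalSpace M]
  [ChartedSpace (EuclideanSpace ℝ (Fin n)) M] [IsManifold (𝓡 n) ∞ M]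
  {φ ψ : OpenPartialHomeomorph M (EuclideanSpace ℝ (Fin n))} (g : LorentzMetric n M)

section

variable (hφ : φ ∈ IsManifold.maximalAtlas (𝓡 n) ∞ M)
  {y : EuclideanSpace ℝ (Fin n)} (hy : y ∈ φ.target)
include hφ hy

theorem differentiableAt_chartForm : DifferentiableAt ℝ (g.chartForm φ) y :=
  ((g.contDiffOn_chartForm hφ).contDiffAt (φ.open_target.mem_nhds hy)).differentiableAt (by simp)

theorem partialD_metric_eq_fderiv (i a b : Fin n) : partialD i (g.metric φ a b) y =
    fderiv ℝ (g.chartForm φ) y (EuclideanSpace.single i 1) (EuclideanSpace.single a 1)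
      (EuclideanSpace.single b 1) := by
  rw [← fderiv_form_apply (g.differentiableAt_chartForm hφ hy)]
  rfl

/-- Koszul's formula: since `Xₗ = gₗₘ Xᵐ`, the term `Γˡⱼₖ Xₗ` contains only the lowered Christoffel
symbols, so the inverse metric cancels. -/
theorem two_mul_covDeriv {X : (p : M) → TangentSpace (𝓡 n) p}
    (hX : ContDiffAt ℝ ∞ (chartVec φ X) y) (j k : Fin n) :
    2 * g.covDeriv φ X j k y = nablaForm (g.chartForm φ) (chartVec φ X) y
      (EuclideanSpace.single j 1) (EuclideanSpace.single k 1) := by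
  have hup : ∀ m, ContDiffAt ℝ ∞ (vecUp φ X m) y := fun m ↦ contDiffAt_euclidean.1 hX m
  have hDX : ∀ m, fderiv ℝ (chartVec φ X) y (EuclideanSpace.single j 1) m =
      partialD j (vecUp φ X m) y := by
    intro m
    have h := ((EuclideanSpace.proj m : EuclideanSpace ℝ (Fin n) →L[ℝ] ℝ).hasFDerivAt.comp y
      (hX.differentiableAt (by simp)).hasFDerivAt).fderiv
    exact (DFunLike.congr_fun h (EuclideanSpace.single j 1)).symm
  have hlow : partialD j (g.vecLow φ X k) y =
      ∑ m, (g.metric φ k m y * partialD j (vecUp φ X m) y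
        + partialD j (g.metric φ k m) y * vecUp φ X m y) := by
    have h : g.vecLow φ X k = fun z ↦ ∑ m, g.metric φ k m z * vecUp φ X m z := rfl
    rw [h, partialD_sum _ _ fun m _ ↦ (g.contDiffAt_metric hφ hy k m).mul (hup m)]
    exact Finset.sum_congr rfl fun m _ ↦ partialD_mul j (g.contDiffAt_metric hφ hy k m) (hup m)
  have hΓ : ∑ l, g.christoffel φ l j k y * g.vecLow φ X l y =
      ∑ m, (∑ l, g.christoffel φ l j k y * g.metric φ l m y) * vecUp φ X m y := by
    simp only [vecLow, Finset.mul_sum, Finset.sum_mul, mul_assoc]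
    exact Finset.sum_comm
  have h1 : g.chartForm φ y (fderiv ℝ (chartVec φ X) y (EuclideanSpace.single j 1))
      (EuclideanSpace.single k 1) = ∑ m, partialD j (vecUp φ X m) y * g.metric φ m k y := by
    rw [chartForm_eq_sum]
    simp [hDX]
  have h2 : ∀ i l, fderiv ℝ (g.chartForm φ) y (EuclideanSpace.single i 1) (chartVec φ X y)
      (EuclideanSpace.single l 1) = ∑ m, vecUp φ X m y * partialD i (g.metric φ m l) y := by
    intro i l
    rw [bilinear_eq_sum]
    simp [← g.partialD_metric_eq_fderiv hφ hy, vecUp_eq_chartVec]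
  have h3 : fderiv ℝ (g.chartForm φ) y (chartVec φ X y) (EuclideanSpace.single j 1)
      (EuclideanSpace.single k 1) = ∑ m, vecUp φ X m y * partialD m (g.metric φ j k) y := by
    rw [← fderiv_form_apply (g.differentiableAt_chartForm hφ hy), fderiv_eq_sum_partialD]
    rfl
  rw [nablaForm_apply, h1, h2, h2, h3, covDeriv, hlow, hΓ, ← Finset.sum_sub_distrib,
    Finset.mul_sum, Finset.mul_sum, ← Finset.sum_add_distrib, ← Finset.sum_sub_distrib,
    ← Finset.sum_add_distrib]
  refine Finset.sum_congr rfl fun m _ ↦ ?_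
  have hm : g.metric φ k m = g.metric φ m k := funext fun z ↦ g.metric_symm k m z
  rw [g.sum_christoffel_mul_metric hφ hy, hm]
  ring

end

/-- The concircular equation can be checked in a single chart. -/
theorem covDeriv_eq_of_chart (hφ : φ ∈ IsManifold.maximalAtlas (𝓡 n) ∞ M)
    (hψ : ψ ∈ IsManifold.maximalAtlas (𝓡 n) ∞ M) {U : Set M} (hU : IsOpen U)
    {X : (p : M) → TangentSpace (𝓡 n) p}
    (hX : ContMDiffOn (𝓡 n) (𝓡 n).tangent ∞ (fun p ↦ (⟨p, X p⟩ : TangentBundle (𝓡 n) M)) U)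
    {y : EuclideanSpace ℝ (Fin n)} (hy : y ∈ ψ.target) (hyφ : ψ.symm y ∈ φ.source)
    (hyU : ψ.symm y ∈ U) {r : ℝ}
    (h : ∀ a b, g.covDeriv φ X a b (φ (ψ.symm y)) = r * g.metric φ a b (φ (ψ.symm y)))
    (j k : Fin n) : g.covDeriv ψ X j k y = r * g.metric ψ j k y := by
  have hy' : φ (ψ.symm y) ∈ φ.target := φ.map_source hyφ
  have hyU' : φ.symm (φ (ψ.symm y)) ∈ U := by rwa [φ.left_inv hyφ]
  have hXψ : ContDiffAt ℝ ∞ (chartVec ψ X) y := (contDiffOn_chartVec hψ hX).contDiffAt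
    ((isOpen_target_inter ψ hU).mem_nhds ⟨hy, hyU⟩)
  have hXφ : ContDiffAt ℝ ∞ (chartVec φ X) (φ (ψ.symm y)) :=
    (contDiffOn_chartVec hφ hX).contDiffAt ((isOpen_target_inter φ hU).mem_nhds ⟨hy', hyU'⟩)
  have hV := (isOpen_target_inter ψ φ.open_source).mem_nhds ⟨hy, hyφ⟩
  have key := nablaForm_pullback (G := g.chartForm ψ) (G' := g.chartForm φ) (W := chartVec ψ X)
    (W' := chartVec φ X) (τ := fun z ↦ φ (ψ.symm z)) (y := y)
    ((contDiffOn_transition hφ hψ).contDiffAt hV) (g.chartForm_symm _) (g.differentiableAt_chartForm hψ hy)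
    (g.differentiableAt_chartForm hφ hy') (hXψ.differentiableAt (by simp))
    (hXφ.differentiableAt (by simp))
    (by
      filter_upwards [hV] with z hz
      exact g.chartForm_transition hφ hψ hz.1 hz.2)
    (by
      filter_upwards [hV] with z hz
      exact chartVec_transition hφ hψ X hz.1 hz.2)
  -- By bilinearity the equation passes from the coordinate vectors of `φ` to all vectors, in
  -- particular to the images of those of `ψ`.
  have hform : ∀ u v, nablaForm (g.chartForm φ) (chartVec φ X) (φ (ψ.symm y)) u v =
      2 * r * g.chartForm φ (φ (ψ.symm y)) u v := by
    intro u v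
    rw [bilinear_eq_sum, chartForm_eq_sum, Finset.mul_sum]
    refine Finset.sum_congr rfl fun a _ ↦ ?_
    rw [Finset.mul_sum]
    refine Finset.sum_congr rfl fun b _ ↦ ?_
    rw [← g.two_mul_covDeriv hφ hy' hXφ, h]
    ring
  have h2 := g.two_mul_covDeriv hψ hy hXψ j k
  rw [key, hform, ← g.chartForm_transition hφ hψ hy hyφ, ← metric_eq_chartForm] at h2
  linarith

end LorentzMetric

/-! ### Vector fields with prescribed components in a chart -/

section CoordinateField

variable {n : ℕ} {M : Type*} [TopologicalSpace M]
  [ChartedSpace (EuclideanSpace ℝ (Fin n)) M]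
  {φ : OpenPartialHomeomorph M (EuclideanSpace ℝ (Fin n))}

/-- The vector field on the source of `φ` whose components in the chart `φ` are `V`. -/
def fieldOfChart (φ : OpenPartialHomeomorph M (EuclideanSpace ℝ (Fin n)))
    (V : EuclideanSpace ℝ (Fin n) → EuclideanSpace ℝ (Fin n)) (p : M) : TangentSpace (𝓡 n) p :=
  (mfderiv (𝓡 n) (𝓡 n) φ.symm (φ p) (V (φ p)) : EuclideanSpace ℝ (Fin n))

theorem chartVec_fieldOfChart (hφ : φ ∈ IsManifold.maximalAtlas (𝓡 n) ∞ M)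
    (V : EuclideanSpace ℝ (Fin n) → EuclideanSpace ℝ (Fin n)) {y : EuclideanSpace ℝ (Fin n)}
    (hy : y ∈ φ.target) : chartVec φ (fieldOfChart φ V) y = V y := by
  refine Eq.trans ?_ (mfderiv_chart_mfderiv_symm hφ hy (V y))
  have h : ∀ z, z = y → ∀ w : EuclideanSpace ℝ (Fin n),
      w = mfderiv (𝓡 n) (𝓡 n) φ.symm z (V z) →
      w = mfderiv (𝓡 n) (𝓡 n) φ.symm y (V y) := by
    rintro z rfl w hw
    exact hw
  exact congrArg (mfderiv (𝓡 n) (𝓡 n) φ (φ.symm y)) (h _ (φ.right_inv hy) _ rfl)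

theorem contMDiffOn_fieldOfChart [IsManifold (𝓡 n) ∞ M]
    (hφ : φ ∈ IsManifold.maximalAtlas (𝓡 n) ∞ M)
    {V : EuclideanSpace ℝ (Fin n) → EuclideanSpace ℝ (Fin n)} (hV : ContDiffOn ℝ ∞ V φ.target) :
    ContMDiffOn (𝓡 n) (𝓡 n).tangent ∞
      (fun p ↦ (⟨p, fieldOfChart φ V p⟩ : TangentBundle (𝓡 n) M)) φ.source := by
  have h1 : ContMDiffOn (𝓡 n) (𝓡 n).tangent ∞
      (fun y ↦ (⟨y, V y⟩ : TangentBundle (𝓡 n) (EuclideanSpace ℝ (Fin n)))) φ.target :=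
    contMDiffOn_vectorSpace_iff_contDiffOn.2 hV
  have h2 := h1.comp (contMDiffOn_of_mem_maximalAtlas hφ) fun p hp ↦ φ.map_source hp
  refine (contMDiffOn_tangentMap_comp φ.open_target (contMDiffOn_symm_of_mem_maximalAtlas hφ) h2
    fun p hp ↦ φ.map_source hp).congr fun p hp ↦ ?_
  have h3 : ∀ (q : M) (v : EuclideanSpace ℝ (Fin n)), q = p →
      (⟨p, v⟩ : TangentBundle (𝓡 n) M) = ⟨q, v⟩ := by
    rintro _ v rfl
    rfl
  exact h3 _ _ (φ.left_inv hp)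

end CoordinateField

/-! ### The Chen vector of a generalized Robertson-Walker metric -/

namespace LorentzMetric

variable {n : ℕ} [NeZero n] {M : Type*} [TopologicalSpace M]
  [ChartedSpace (EuclideanSpace ℝ (Fin n)) M] [IsManifold (𝓡 n) ∞ M]
  {φ : OpenPartialHomeomorph M (EuclideanSpace ℝ (Fin n))} (g : LorentzMetric n M)

set_option synthInstance.maxHeartbeats 200000 in
/-- In coordinates with `ds² = -dt² + q(t)² h(x)`, the field `q ∂ₜ` is concircular. -/
theorem covDeriv_eq_deriv_mul_metric (hφ : φ ∈ IsManifold.maximalAtlas (𝓡 n) ∞ M) {q : ℝ → ℝ}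
    {h : ({i : Fin n // i ≠ 0} → ℝ) → Matrix {i : Fin n // i ≠ 0} {i : Fin n // i ≠ 0} ℝ}
    (hq : ∀ y ∈ φ.target, ContDiffAt ℝ ∞ q (y 0))
    (h00 : ∀ y ∈ φ.target, g.metric φ 0 0 y = -1)
    (h0a : ∀ y ∈ φ.target, ∀ a : {i : Fin n // i ≠ 0}, g.metric φ 0 a y = 0)
    (hab : ∀ y ∈ φ.target, ∀ a b : {i : Fin n // i ≠ 0},
      g.metric φ a b y = q (y 0) ^ 2 * h (fun c ↦ y c) a b)
    {X : (p : M) → TangentSpace (𝓡 n) p}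
    (hX : ∀ y ∈ φ.target, chartVec φ X y = q (y 0) • EuclideanSpace.single 0 1)
    {y : EuclideanSpace ℝ (Fin n)} (hy : y ∈ φ.target) (a b : Fin n) :
    g.covDeriv φ X a b y = deriv q (y 0) * g.metric φ a b y := by
  have hnhds := φ.open_target.mem_nhds hy
  have hy0 : ContDiffAt ℝ ∞ (fun z : EuclideanSpace ℝ (Fin n) ↦ z 0) y :=
    contDiffAt_euclidean.1 contDiffAt_id 0
  have hW : ContDiffAt ℝ ∞ (fun z : EuclideanSpace ℝ (Fin n) ↦
      q (z 0) • EuclideanSpace.single (0 : Fin n) (1 : ℝ)) y :=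
    ((hq y hy).comp y hy0).smul contDiffAt_const
  have hWev : chartVec φ X =ᶠ[nhds y] fun z ↦ q (z 0) • EuclideanSpace.single 0 1 := by
    filter_upwards [hnhds] with z hz using hX z hz
  have hXs : ContDiffAt ℝ ∞ (chartVec φ X) y := hW.congr_of_eventuallyEq hWev
  have hline : ∀ v : EuclideanSpace ℝ (Fin n),
      HasDerivAt (fun s : ℝ ↦ y + s • v) v 0 := fun v ↦ by
    simpa using ((hasDerivAt_id (0 : ℝ)).smul_const v).const_add y
  have hproj : HasFDerivAt (fun z : EuclideanSpace ℝ (Fin n) ↦ z 0)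
      (EuclideanSpace.proj 0 : EuclideanSpace ℝ (Fin n) →L[ℝ] ℝ) y :=
    (EuclideanSpace.proj 0 : EuclideanSpace ℝ (Fin n) →L[ℝ] ℝ).hasFDerivAt
  have hqd : HasDerivAt q (deriv q (y 0)) (y 0) :=
    ((hq y hy).differentiableAt (by simp)).hasDerivAt
  have hDW : ∀ v, fderiv ℝ (chartVec φ X) y v =
      (deriv q (y 0) * v 0) • EuclideanSpace.single 0 1 := by
    intro v
    have h1 := (hqd.comp_hasFDerivAt y hproj).smul_const (EuclideanSpace.single (0 : Fin n) (1 : ℝ))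
    rw [hWev.fderiv_eq]
    have h2 := DFunLike.congr_fun h1.fderiv v
    simpa using h2
  have hconst : ∀ i b, partialD i (g.metric φ 0 b) y = 0 := by
    intro i b
    have : ∀ᶠ z in nhds y, g.metric φ 0 b z = if b = 0 then -1 else 0 := by
      filter_upwards [hnhds] with z hz
      split_ifs with hb
      · rw [hb, h00 z hz]
      · exact h0a z hz ⟨b, hb⟩
    rw [partialD_congr i this]
    simp [partialD]
  have hsymm : ∀ a b, g.metric φ a b = g.metric φ b a := fun a b ↦
    funext fun z ↦ g.metric_symm a b z
  -- On spatial components `∂ₜ(q² h) = 2 q q' h`; the subtracted row `a = 0` makes the identity hold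
  -- for all indices, the components `g₀ᵦ` being constant.
  have htime : q (y 0) * partialD 0 (g.metric φ a b) y =
      2 * deriv q (y 0) * (g.metric φ a b y - if a = 0 then g.metric φ 0 b y else 0) := by
    by_cases ha : a = 0
    · simp [ha, hconst]
    by_cases hb : b = 0
    · rw [hb, hsymm a 0, hconst, h0a y hy ⟨a, ha⟩]
      simp [ha]
    -- Along the line through `y` in the direction `∂ₜ` the space coordinates are fixed, so `h` is a
    -- constant factor there.
    have h1 : HasDerivAt (fun s : ℝ ↦ g.metric φ a b (y + s • EuclideanSpace.single 0 1))
        (partialD 0 (g.metric φ a b) y) 0 := by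
      have hd := ((g.contDiffAt_metric hφ hy a b).differentiableAt (by simp)).hasFDerivAt
      exact HasFDerivAt.comp_hasDerivAt_of_eq 0 hd (hline _) (by simp)
    have h2 : HasDerivAt (fun s : ℝ ↦ q (y 0 + s) ^ 2 * h (fun c ↦ y c) ⟨a, ha⟩ ⟨b, hb⟩)
        (2 * q (y 0) * deriv q (y 0) * h (fun c ↦ y c) ⟨a, ha⟩ ⟨b, hb⟩) 0 := by
      have hq' : HasDerivAt (fun s : ℝ ↦ q (y 0 + s)) (deriv q (y 0)) 0 :=
        HasDerivAt.comp_const_add (y 0) 0 (by simpa using hqd)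
      simpa [mul_assoc] using (hq'.pow 2).mul_const (h (fun c ↦ y c) ⟨a, ha⟩ ⟨b, hb⟩)
    have hev : (fun s : ℝ ↦ g.metric φ a b (y + s • EuclideanSpace.single 0 1)) =ᶠ[nhds 0]
        fun s : ℝ ↦ q (y 0 + s) ^ 2 * h (fun c ↦ y c) ⟨a, ha⟩ ⟨b, hb⟩ := by
      have hc : Filter.Tendsto (fun s : ℝ ↦ y + s • EuclideanSpace.single (0 : Fin n) (1 : ℝ))
          (nhds 0) (nhds y) := by
        simpa using (hline (EuclideanSpace.single 0 1)).continuousAt.tendsto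
      filter_upwards [hc hnhds] with s hs
      have h3 := hab _ hs ⟨a, ha⟩ ⟨b, hb⟩
      have h4 : (fun c : {i : Fin n // i ≠ 0} ↦
          (y + s • EuclideanSpace.single (0 : Fin n) (1 : ℝ)) c) = fun c : {i : Fin n // i ≠ 0} ↦ y c := by
        funext c
        simp [c.2]
      rw [h4] at h3
      simpa using h3
    rw [h1.unique (h2.congr_of_eventuallyEq hev), hab y hy ⟨a, ha⟩ ⟨b, hb⟩]
    simp only [ha, if_false]
    ring
  -- In Koszul's formula for `q ∂ₜ` the two middle terms differentiate the constants `g₀ᵦ`; the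
  -- first supplies exactly the row `a = 0` that `htime` subtracts from the last.
  have key := g.two_mul_covDeriv hφ hy hXs a b
  rw [nablaForm_apply, hDW, hX y hy] at key
  simp only [map_smul, smul_apply, smul_eq_mul, ← metric_eq_chartForm,
    ← g.partialD_metric_eq_fderiv hφ hy, hconst, htime] at key
  by_cases ha : a = 0
  · simp [ha] at key
    rw [ha]
    linarith
  · simp [ha, Ne.symm ha] at key
    linarith

theorem IsGRW.exists_isChenVector {g : LorentzMetric n M} (hg : g.IsGRW) (p : M) :
    ∃ (U : Set M) (X : (p : M) → TangentSpace (𝓡 n) p) (ρ : M → ℝ),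
      IsOpen U ∧ p ∈ U ∧ g.IsChenVector U X ρ := by
  obtain ⟨φ, hφ, hp, q, h, hq, -, hgrw⟩ := hg p
  -- The time projection is an open map, so smoothness of `q` on the image is smoothness at each
  -- point and passes to `deriv q`.
  have hopen : IsOpen ((fun y : EuclideanSpace ℝ (Fin n) ↦ y 0) '' φ.target) := by
    refine (EuclideanSpace.proj 0 : EuclideanSpace ℝ (Fin n) →L[ℝ] ℝ).isOpenMap (fun s ↦
      ⟨EuclideanSpace.single 0 s, by simp⟩) _ φ.open_target
  have hproj : ContDiffOn ℝ ∞ (fun y : EuclideanSpace ℝ (Fin n) ↦ y 0) φ.target :=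
    (EuclideanSpace.proj 0 : EuclideanSpace ℝ (Fin n) →L[ℝ] ℝ).contDiff.contDiffOn
  have hqd : ∀ y ∈ φ.target, ContDiffAt ℝ ∞ q (y 0) := fun y hy ↦
    hq.contDiffAt (hopen.mem_nhds ⟨y, hy, rfl⟩)
  set V : EuclideanSpace ℝ (Fin n) → EuclideanSpace ℝ (Fin n) :=
    fun y ↦ q (y 0) • EuclideanSpace.single 0 1
  have hV : ContDiffOn ℝ ∞ V φ.target :=
    (hq.comp hproj fun y hy ↦ ⟨y, hy, rfl⟩).smul contDiffOn_const
  have hX := contMDiffOn_fieldOfChart hφ hV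
  -- The witness is `X = q ∂ₜ` with `ρ = q'`, on the whole domain of the adapted chart.
  refine ⟨φ.source, fieldOfChart φ V, fun p ↦ deriv q (φ p 0), φ.open_source, hp, hX, ?_, ?_, ?_⟩
  · have h1 : ContDiffOn ℝ ∞ (fun y : EuclideanSpace ℝ (Fin n) ↦ deriv q (y 0)) φ.target :=
      (hq.deriv_of_isOpen hopen (m := ∞) (by simp)).comp hproj fun y hy ↦ ⟨y, hy, rfl⟩
    exact (contMDiffOn_iff_contDiffOn.2 h1).comp (contMDiffOn_of_mem_maximalAtlas hφ)
      fun p hp ↦ φ.map_source hp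
  · intro x hx
    have hx' := φ.map_source hx
    have h1 := g.chartForm_chartVec hφ (fieldOfChart φ V) hx'
    rw [chartVec_fieldOfChart hφ V hx', φ.left_inv hx] at h1
    rw [← h1]
    simp only [V, map_smul, smul_apply, smul_eq_mul, ← metric_eq_chartForm]
    obtain ⟨h2, -, h3, -⟩ := hgrw _ hx'
    rw [h3]
    nlinarith
  · intro ψ hψ y hy hyφ j k
    refine g.covDeriv_eq_of_chart hφ hψ φ.open_source hX hy hyφ hyφ (fun a b ↦ ?_) j k
    exact g.covDeriv_eq_deriv_mul_metric hφ hqd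
      (fun y hy ↦ (hgrw y hy).2.2.1) (fun y hy a ↦ ((hgrw y hy).2.2.2.1 a).1)
      (fun y hy ↦ (hgrw y hy).2.2.2.2) (fun y hy ↦ chartVec_fieldOfChart hφ V hy)
      (φ.map_source hyφ) a b

end LorentzMetric

end GRW

end

theorem mainTheorem4 (n : ℕ) [NeZero n] (hn : 3 ≤ n) {M : Type*} [TopologicalSpace M]
    [ChartedSpace (EuclideanSpace ℝ (Fin n)) M] [IsManifold (𝓡 n) ∞ M]
    (g : GRW.LorentzMetric n M) :
    (g.IsGRW → ∀ p : M, ∃ (U : Set M) (X : (p : M) → TangentSpace (𝓡 n) p) (ρ : M → ℝ),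
      IsOpen U ∧ p ∈ U ∧ g.IsChenVector U X ρ) ∧
    ∀ (U : Set M) (X : (p : M) → TangentSpace (𝓡 n) p) (ρ : M → ℝ),
      IsOpen U → g.IsChenVector U X ρ →
      ∃ ξ θ : M → ℝ,
        ContMDiffOn (𝓡 n) 𝓘(ℝ, ℝ) ∞ ξ U ∧ ContMDiffOn (𝓡 n) 𝓘(ℝ, ℝ) ∞ θ U ∧
        ∀ φ ∈ IsManifold.maximalAtlas (𝓡 n) ∞ M, ∀ y ∈ φ.target, φ.symm y ∈ U →
          (∀ j, ∑ m, g.ricci φ j m y * GRW.vecUp φ X m y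
            = ξ (φ.symm y) * g.vecLow φ X j y) ∧
          (ξ (φ.symm y) = -((n : ℝ) - 1)
            * (∑ k, GRW.vecUp φ X k y * GRW.partialD k (fun z ↦ ρ (φ.symm z)) y)
            / g.sqNorm φ X y) ∧
          (∀ i, GRW.partialD i (fun z ↦ ξ (φ.symm z)) y = θ (φ.symm y) * g.vecLow φ X i y) ∧
          (∀ k l, g.ricci φ k l y
            = ((n : ℝ) - 2) * (∑ j, ∑ m, g.weyl φ j k l m y
                * (GRW.vecUp φ X j y * GRW.vecUp φ X m y / g.sqNorm φ X y))
              + (g.scalarCurv φ y - ξ (φ.symm y)) / ((n : ℝ) - 1)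
                * (g.metric φ k l y - g.vecLow φ X k y * g.vecLow φ X l y / g.sqNorm φ X y)
              + ξ (φ.symm y) * (g.vecLow φ X k y * g.vecLow φ X l y / g.sqNorm φ X y)) :=
  ⟨fun hg p ↦ hg.exists_isChenVector p, fun _ _ _ hU hX ↦ hX.exists_ricci_eq hn hU⟩
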